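/- Let $\alpha\ge\beta\ge-1/2$, $\alpha>-1/2$, $\tau>0$, $\rho=\alpha+\beta+1$ and $\Delta(t)=2^{2\rho}(\sinh t)^{2\alpha+1}(\cosh t)^{2\beta+1}$. For real $\lambda$ let the Jacobi function $\varphi_\lambda$ be the even function on $\mathbb{R}$ that solves $(\Delta\varphi_\lambda')'+(\lambda^2+\rho^2)\Delta\varphi_\lambda=0$ for $t>0$, with $\varphi_\lambda(0)=1$, $\varphi_\lambda'(0)=0$, and put $\psi_\lambda=\varphi_\lambda/\varphi_0$. Let $0<\lambda_1(\tau)<\lambda_2(\tau)<\cdots$ be the positive zeros of $\lambda\mapsto\varphi_\lambda(\tau)$, and let $0<\lambda_1^*(\tau)<\lambda_2^*(\tau)<\cdots$ be the positive zeros of $\lambda\mapsto\psi_\lambda'(\tau)$, where $'$ denotes the derivative in $t$. For an interval $I$ let $N_I(p)$ be the number of zeros of $p$ on $I$, where zeros in the interior of $I$ are counted with multiplicity and a zero at an endpoint belonging to $I$ is counted once. A sequence $f_1,f_2,\dots$ of real functions is a Chebyshev system on $I$ if $N_I(p)\le n-1$ for every $n\ge1$ and every $p=\sum_{k=1}^nA_kf_k$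 with real coefficients $A_1,\dots,A_n$ that are not all zero. (i) $\{\psi_{\lambda_k(\tau)}\}_{k=1}^\infty$ is a Chebyshev system on $(0,\tau)$, and $\{1\}\cup\{\psi_{\lambda_k^*(\tau)}\}_{k=1}^\infty$ (in this order, the constant function first) is a Chebyshev system on $[0,\tau]$. (ii) $\{\psi_{\lambda_k^*(\tau)}'\}_{k=1}^\infty$ and $\{\psi_{\lambda_k^*(\tau)}-\psi_{\lambda_k^*(\tau)}(\tau)\}_{k=1}^\infty$ are Chebyshev systems on $(0,\tau)$. -/

import Mathlib

/-- The parameter `ρ = α + β + 1`. -/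
noncomputable def jacobiRho (α β : ℝ) : ℝ := α + β + 1

/-- The weight `Δ(t) = 2^{2ρ} (sinh t)^{2α+1} (cosh t)^{2β+1}`. -/
noncomputable def jacobiWeight (α β t : ℝ) : ℝ :=
  (2 : ℝ) ^ (2 * jacobiRho α β) * Real.sinh t ^ (2 * α + 1) * Real.cosh t ^ (2 * β + 1)

/-- `φ` is the even function on `ℝ` that solves, on `t > 0`, the Sturm–Liouville problem
`(Δ φ')' + (lam² + ρ²) Δ φ = 0`, `φ(0) = 1`, `φ'(0) = 0`. -/
structure IsJacobiFunction (α β lam : ℝ) (φ : ℝ → ℝ) : Prop where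
  even : ∀ t, φ (-t) = φ t
  map_zero : φ 0 = 1
  deriv_zero : HasDerivAt φ 0 0
  differentiable : ∀ t, 0 < t → DifferentiableAt ℝ φ t
  ode : ∀ t, 0 < t → HasDerivAt (fun s => jacobiWeight α β s * deriv φ s)
    (-((lam ^ 2 + jacobiRho α β ^ 2) * jacobiWeight α β t * φ t)) t

/-- The Jacobi function `φ_lam^{(α,β)}`: the solution of the Sturm–Liouville problem.
It exists and is unique for `α ≥ β ≥ -1/2`, `α > -1/2`, see `jacobiPhi_spec` and
`IsJacobiFunction.eq_jacobiPhi`. -/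
noncomputable def jacobiPhi (α β lam : ℝ) : ℝ → ℝ :=
  Classical.epsilon (IsJacobiFunction α β lam)

namespace JacobiAux

open Filter Topology Set

/-- One step of the successive approximations: `w(s)⁻¹ ∫₀ˢ w f`. -/
noncomputable def inner (w f : ℝ → ℝ) (s : ℝ) : ℝ := (w s)⁻¹ * ∫ r in (0 : ℝ)..s, w r * f r

/-- Successive approximations for `(w φ')' = w φ`, `φ(0) = 1`, `φ'(0) = 0`. -/
noncomputable def approx (w : ℝ → ℝ) : ℕ → ℝ → ℝ
  | 0 => fun _ => 1
  | k + 1 => fun t => ∫ s in (0 : ℝ)..t, inner w (approx w k) s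

theorem inner_bound {w f : ℝ → ℝ} (hpos : ∀ t, t ≠ 0 → 0 < w t)
    (hmono : ∀ s t, |s| ≤ |t| → w s ≤ w t) (h0 : 0 ≤ w 0) (k : ℕ)
    (hb : ∀ t, |f t| ≤ (t ^ 2) ^ k / k.factorial) (t : ℝ) :
    |inner w f t| ≤ |t| * ((t ^ 2) ^ k / k.factorial) := by
  by_cases ht : t = 0
  · subst ht; simp [inner]
  have hw : 0 < w t := hpos t ht
  have hwn : ∀ s, 0 ≤ w s := fun s => by
    by_cases hs : s = 0
    · rw [hs]; exact h0
    · exact (hpos s hs).le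
  have key : ‖∫ r in (0 : ℝ)..t, w r * f r‖ ≤
      (w t * ((t ^ 2) ^ k / k.factorial)) * |t - 0| := by
    apply intervalIntegral.norm_integral_le_of_norm_le_const
    intro x hx
    have hxt : |x| ≤ |t| := by
      have := Set.abs_sub_left_of_mem_uIcc (Set.uIoc_subset_uIcc hx)
      simpa using this
    rw [Real.norm_eq_abs, abs_mul, abs_of_nonneg (hwn x)]
    have h2 : x ^ 2 ≤ t ^ 2 := sq_le_sq.2 hxt
    have h3 : |f x| ≤ (t ^ 2) ^ k / k.factorial := (hb x).trans (by gcongr)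
    exact mul_le_mul (hmono x t hxt) h3 (abs_nonneg _) hw.le
  rw [Real.norm_eq_abs, sub_zero] at key
  rw [inner, abs_mul, abs_inv, abs_of_pos hw]
  calc (w t)⁻¹ * |∫ r in (0 : ℝ)..t, w r * f r|
      ≤ (w t)⁻¹ * ((w t * ((t ^ 2) ^ k / k.factorial)) * |t|) := by gcongr
    _ = |t| * ((t ^ 2) ^ k / k.factorial) := by field_simp

theorem inner_continuous {w f : ℝ → ℝ} (hw : Continuous w) (hpos : ∀ t, t ≠ 0 → 0 < w t)
    (hmono : ∀ s t, |s| ≤ |t| → w s ≤ w t) (h0 : 0 ≤ w 0) (k : ℕ) (hf : Continuous f)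
    (hb : ∀ t, |f t| ≤ (t ^ 2) ^ k / k.factorial) : Continuous (inner w f) := by
  rw [continuous_iff_continuousAt]
  intro t
  by_cases ht : t = 0
  · subst ht
    have h1 : inner w f 0 = 0 := by simp [inner]
    rw [ContinuousAt, h1]
    have hlim : Tendsto (fun t : ℝ => |t| * ((t ^ 2) ^ k / k.factorial)) (𝓝 0) (𝓝 0) := by
      have : Continuous (fun t : ℝ => |t| * ((t ^ 2) ^ k / k.factorial)) := by fun_prop
      simpa using this.tendsto 0
    exact squeeze_zero_norm (fun t => by
      simpa using inner_bound hpos hmono h0 k hb t) hlim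
  · have hc : Continuous (fun t => ∫ r in (0 : ℝ)..t, w r * f r) :=
      intervalIntegral.continuous_primitive
        (fun a b => (hw.mul hf).intervalIntegrable a b) 0
    exact (hw.continuousAt.inv₀ (hpos t ht).ne').mul hc.continuousAt

theorem int_odd_pow (k : ℕ) (t : ℝ) : HasDerivAt
    (fun x : ℝ => (x ^ 2) ^ (k + 1) / (k + 1).factorial)
    (2 * (t * ((t ^ 2) ^ k / k.factorial))) t := by
  have h := (((hasDerivAt_id t).pow 2).pow (k + 1)).div_const ((k + 1).factorial : ℝ)
  refine h.congr_deriv ?_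
  rw [Nat.factorial_succ]
  push_cast
  simp only [id, Pi.pow_apply]
  field_simp

theorem bound_of_deriv_bound {F F' : ℝ → ℝ} (k : ℕ) (C : ℝ)
    (hC : 0 ≤ C) (T : ℝ) (h0 : F 0 = 0) (hF : ContinuousOn F (Icc 0 T))
    (hd : ∀ t ∈ Ico 0 T, HasDerivWithinAt F (F' t) (Ici t) t)
    (hb : ∀ t ∈ Ico 0 T, |F' t| ≤ C * (t * ((t ^ 2) ^ k / k.factorial))) :
    ∀ t ∈ Icc 0 T, |F t| ≤ C * ((t ^ 2) ^ (k + 1) / (k + 1).factorial) := by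
  intro t ht
  refine image_norm_le_of_norm_deriv_right_le_deriv_boundary (f := F) (f' := F') hF hd
    (B := fun x => C * ((x ^ 2) ^ (k + 1) / (k + 1).factorial)) ?_
    (fun x => (int_odd_pow k x).const_mul C) ?_ ht
  · simp [h0]
  · intro x hx
    refine (hb x hx).trans ?_
    have : 0 ≤ x * ((x ^ 2) ^ k / (k.factorial : ℝ)) := by
      have := hx.1
      positivity
    nlinarith [mul_nonneg hC this]

theorem approx_spec {w : ℝ → ℝ} (hw : Continuous w) (hpos : ∀ t, t ≠ 0 → 0 < w t)
    (hmono : ∀ s t, |s| ≤ |t| → w s ≤ w t) (h0 : 0 ≤ w 0) (k : ℕ) :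
    Continuous (approx w k) ∧ (∀ t, approx w k (-t) = approx w k t) ∧
      ∀ t, |approx w k t| ≤ (t ^ 2) ^ k / k.factorial := by
  have heven : ∀ t, w (-t) = w t := fun t =>
    le_antisymm (hmono _ _ (by simp)) (hmono _ _ (by simp))
  induction k with
  | zero => exact ⟨continuous_const, fun _ => rfl, fun t => by simp [approx]⟩
  | succ k ih =>
    obtain ⟨hc, he, hb⟩ := ih
    have hg := inner_continuous hw hpos hmono h0 k hc hb
    have hgb := inner_bound hpos hmono h0 k hb
    have hcont : Continuous (approx w (k + 1)) :=
      intervalIntegral.continuous_primitive (fun a b => hg.intervalIntegrable a b) 0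
    have hodd : ∀ s, inner w (approx w k) (-s) = -inner w (approx w k) s := by
      intro s
      have h := intervalIntegral.integral_comp_neg (a := (0 : ℝ)) (b := s)
        (fun r => w r * approx w k r)
      simp only [heven, he, neg_zero] at h
      rw [inner, inner, heven, h, intervalIntegral.integral_symm, mul_neg]
    have heven' : ∀ t, approx w (k + 1) (-t) = approx w (k + 1) t := by
      intro t
      have h := intervalIntegral.integral_comp_neg (a := (0 : ℝ)) (b := t)
        (inner w (approx w k))
      simp only [hodd, neg_zero, intervalIntegral.integral_neg] at h
      change ∫ s in (0 : ℝ)..(-t), inner w (approx w k) s = ∫ s in (0 : ℝ)..t, _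
      rw [intervalIntegral.integral_symm, ← h, neg_neg]
    refine ⟨hcont, heven', ?_⟩
    have hpart : ∀ t, 0 ≤ t → |approx w (k + 1) t| ≤ (t ^ 2) ^ (k + 1) / (k + 1).factorial := by
      intro t ht
      have := bound_of_deriv_bound (F := approx w (k + 1)) (F' := inner w (approx w k)) k 1
        zero_le_one t (by simp [approx]) hcont.continuousOn
        (fun x _ => (hg.integral_hasStrictDerivAt 0 x).hasDerivAt.hasDerivWithinAt)
        (fun x hx => by
          have := hgb x
          rwa [abs_of_nonneg hx.1, ← one_mul (x * _)] at this) t ⟨ht, le_rfl⟩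
      simpa using this
    intro t
    rcases le_total 0 t with ht | ht
    · exact hpart t ht
    · have := hpart (-t) (by linarith)
      rwa [heven', neg_sq] at this

theorem exists_solution {w : ℝ → ℝ} (hw : Continuous w) (hpos : ∀ t, t ≠ 0 → 0 < w t)
    (hmono : ∀ s t, |s| ≤ |t| → w s ≤ w t) (h0 : 0 ≤ w 0) (μ : ℝ) :
    ∃ f D : ℝ → ℝ, (∀ t, f (-t) = f t) ∧ f 0 = 1 ∧ (∀ t, HasDerivAt f (D t) t) ∧ D 0 = 0 ∧
      ∀ t, 0 < t → HasDerivAt (fun s => w s * D s) (-(μ * w t * f t)) t := by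
  have hs := approx_spec hw hpos hmono h0
  have hwn : ∀ s, 0 ≤ w s := fun s => by
    by_cases hs : s = 0
    · rw [hs]; exact h0
    · exact (hpos s hs).le
  obtain ⟨g, hgdef⟩ : ∃ g : ℕ → ℝ → ℝ, g = fun k => inner w (approx w k) := ⟨_, rfl⟩
  have hgc : ∀ k, Continuous (g k) := fun k => by
    rw [hgdef]
    exact inner_continuous hw hpos hmono h0 k (hs k).1 (hs k).2.2
  have hgb : ∀ k t, |g k t| ≤ |t| * ((t ^ 2) ^ k / k.factorial) := fun k => by
    rw [hgdef]
    exact inner_bound hpos hmono h0 k (hs k).2.2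
  have hgd : ∀ k t, HasDerivAt (approx w (k + 1)) (g k t) t := fun k t => by
    have h := ((hgc k).integral_hasStrictDerivAt 0 t).hasDerivAt
    rw [hgdef] at h ⊢
    exact h
  have hsumT : ∀ T C : ℝ, Summable (fun k : ℕ => C * ((|μ| * T ^ 2) ^ k / k.factorial)) :=
    fun T C => (Real.summable_pow_div_factorial _).mul_left C
  have hterm : ∀ (k : ℕ) (T t : ℝ), |t| ≤ T →
      |μ| ^ (k + 1) * ((t ^ 2) ^ k / k.factorial) ≤ |μ| * ((|μ| * T ^ 2) ^ k / k.factorial) := by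
    intro k T t ht
    have h2 : t ^ 2 ≤ T ^ 2 := by
      rw [← sq_abs t]; exact pow_le_pow_left₀ (abs_nonneg t) ht 2
    calc |μ| ^ (k + 1) * ((t ^ 2) ^ k / k.factorial)
        ≤ |μ| ^ (k + 1) * ((T ^ 2) ^ k / k.factorial) := by gcongr
      _ = _ := by rw [mul_pow]; ring
  have hsumA : ∀ t, Summable (fun k => (-μ) ^ (k + 1) * approx w (k + 1) t) := by
    intro t
    have h1 : Summable (fun k => (-μ) ^ k * approx w k t) := by
      refine Summable.of_norm_bounded (hsumT t 1) (fun k => ?_)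
      rw [Real.norm_eq_abs, abs_mul, abs_pow, abs_neg, mul_pow, one_mul, mul_div_assoc]
      gcongr
      exact (hs k).2.2 t
    exact (summable_nat_add_iff (f := fun k => (-μ) ^ k * approx w k t) 1).2 h1
  refine ⟨fun t => 1 + ∑' k, (-μ) ^ (k + 1) * approx w (k + 1) t,
    fun t => ∑' k, (-μ) ^ (k + 1) * g k t, ?_, ?_, ?_, ?_, ?_⟩
  · intro t
    simp only [(hs _).2.1]
  · have : ∀ k, approx w (k + 1) 0 = 0 := fun k => by simp [approx]
    simp [this]
  · intro t
    refine HasDerivAt.const_add 1 ?_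
    refine hasDerivAt_tsum_of_isPreconnected
      (g := fun k s => (-μ) ^ (k + 1) * approx w (k + 1) s)
      (g' := fun k s => (-μ) ^ (k + 1) * g k s)
      (u := fun k : ℕ => ((|t| + 1) * |μ|) * ((|μ| * (|t| + 1) ^ 2) ^ k / k.factorial))
      (t := Ioo (-(|t| + 1)) (|t| + 1)) (y₀ := t) (hsumT _ _) isOpen_Ioo isPreconnected_Ioo
      ?_ ?_ ?_ (hsumA t) ?_
    · intro k y _
      exact (hgd k y).const_mul ((-μ) ^ (k + 1))
    · intro k y hy
      have hy' : |y| ≤ |t| + 1 := (abs_lt.2 hy).le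
      rw [Real.norm_eq_abs, abs_mul, abs_pow, abs_neg]
      calc |μ| ^ (k + 1) * |g k y| ≤ |μ| ^ (k + 1) * (|y| * ((y ^ 2) ^ k / k.factorial)) := by
            gcongr; exact hgb k y
        _ = |y| * (|μ| ^ (k + 1) * ((y ^ 2) ^ k / k.factorial)) := by ring
        _ ≤ (|t| + 1) * (|μ| * ((|μ| * (|t| + 1) ^ 2) ^ k / k.factorial)) :=
            mul_le_mul hy' (hterm k _ y hy') (by positivity) (by positivity)
        _ = _ := by ring
    · exact abs_lt.1 (by linarith)
    · exact abs_lt.1 (by linarith)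
  · have : ∀ k, g k 0 = 0 := fun k => by simp [hgdef, inner]
    simp [this]
  · intro t ht
    have hV : HasDerivAt (fun s => ∑' k, (-μ) ^ (k + 1) * ∫ r in (0 : ℝ)..s, w r * approx w k r)
        (∑' k, (-μ) ^ (k + 1) * (w t * approx w k t)) t := by
      refine hasDerivAt_tsum_of_isPreconnected
        (g := fun k s => (-μ) ^ (k + 1) * ∫ r in (0 : ℝ)..s, w r * approx w k r)
        (g' := fun k s => (-μ) ^ (k + 1) * (w s * approx w k s))
        (u := fun k : ℕ => (w (t + 1) * |μ|) * ((|μ| * (t + 1) ^ 2) ^ k / k.factorial))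
        (t := Ioo (-(t + 1)) (t + 1)) (y₀ := 0) (hsumT _ _) isOpen_Ioo isPreconnected_Ioo
        ?_ ?_ ?_ ?_ ?_
      · intro k y _
        exact ((hw.mul (hs k).1).integral_hasStrictDerivAt 0 y).hasDerivAt.const_mul _
      · intro k y hy
        have hy' : |y| ≤ t + 1 := (abs_lt.2 hy).le
        rw [Real.norm_eq_abs, abs_mul, abs_pow, abs_neg, abs_mul, abs_of_nonneg (hwn y)]
        have hyw : w y ≤ w (t + 1) := hmono _ _ (by rwa [abs_of_pos (by linarith : 0 < t + 1)])
        calc |μ| ^ (k + 1) * (w y * |approx w k y|)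
            ≤ |μ| ^ (k + 1) * (w y * ((y ^ 2) ^ k / k.factorial)) := by
              have := hwn y
              gcongr; exact (hs k).2.2 y
          _ = w y * (|μ| ^ (k + 1) * ((y ^ 2) ^ k / k.factorial)) := by ring
          _ ≤ w (t + 1) * (|μ| * ((|μ| * (t + 1) ^ 2) ^ k / k.factorial)) :=
              mul_le_mul hyw (hterm k _ y hy') (by positivity) (hwn _)
          _ = _ := by ring
      · constructor <;> linarith
      · simp
      · constructor <;> linarith
    have hval : ∑' k, (-μ) ^ (k + 1) * (w t * approx w k t) =
        -(μ * w t * (1 + ∑' k, (-μ) ^ (k + 1) * approx w (k + 1) t)) := by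
      have h1 : ∑' k, (-μ) ^ k * approx w k t =
          1 + ∑' k, (-μ) ^ (k + 1) * approx w (k + 1) t := by
        rw [((summable_nat_add_iff (f := fun k => (-μ) ^ k * approx w k t) 1).1
          (hsumA t)).tsum_eq_zero_add]
        simp [approx]
      rw [← h1, ← neg_mul, ← tsum_mul_left]
      exact tsum_congr fun k => by ring
    rw [hval] at hV
    refine hV.congr_of_eventuallyEq ?_
    filter_upwards [lt_mem_nhds ht] with s hs'
    rw [← tsum_mul_left]
    refine tsum_congr fun k => ?_
    simp only [hgdef, inner]
    have := (hpos s hs'.ne').ne'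
    field_simp

theorem unique_solution {w : ℝ → ℝ} (hpos : ∀ t, t ≠ 0 → 0 < w t)
    (hmono : ∀ s t, |s| ≤ |t| → w s ≤ w t) (μ : ℝ) {d D : ℝ → ℝ}
    (h0 : d 0 = 0) (hd0 : HasDerivAt d 0 0) (hd : ∀ t, 0 < t → HasDerivAt d (D t) t)
    (hode : ∀ t, 0 < t → HasDerivAt (fun s => w s * D s) (-(μ * w t * d t)) t) :
    ∀ T, 0 < T → d T = 0 := by
  intro T hT
  have hdc : ContinuousOn d (Icc 0 T) := by
    intro t ht
    rcases ht.1.eq_or_lt with h | h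
    · exact (h ▸ hd0.continuousAt).continuousWithinAt
    · exact (hd t h).continuousAt.continuousWithinAt
  obtain ⟨M, hM⟩ := isCompact_Icc.exists_bound_of_continuousOn hdc
  have hM0 : 0 ≤ M := (norm_nonneg _).trans (hM 0 ⟨le_rfl, hT.le⟩)
  -- a bound on `d` yields a bound on its derivative
  have step : ∀ (B : ℝ → ℝ), (∀ s t, 0 ≤ s → s ≤ t → B s ≤ B t) →
      (∀ t ∈ Icc 0 T, |d t| ≤ B t) → ∀ t ∈ Ioc 0 T, |D t| ≤ |μ| * (t * B t) := by
    intro B hB hdB t ht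
    have hB0 : 0 ≤ B t := (abs_nonneg _).trans (hdB t ⟨ht.1.le, ht.2⟩)
    have hwt := hpos t ht.1.ne'
    have main : ∀ ε > 0, w t * |D t| ≤ |μ| * (w t * B t) * t + w t * ε := by
      intro ε hε
      have hsl := hd0.isLittleO.def hε
      simp only [h0, sub_zero, smul_zero, Real.norm_eq_abs] at hsl
      obtain ⟨δ, hδ, hball⟩ := Metric.eventually_nhds_iff.1 hsl
      set s := min (δ / 2) (t / 2) with hsdef
      have hs0 : 0 < s := lt_min (by linarith) (by linarith [ht.1])
      have hst : s < t := (min_le_right _ _).trans_lt (by linarith [ht.1])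
      have hds : |d s| ≤ ε * s := by
        have := hball (y := s) (by
          rw [Real.dist_eq, sub_zero, abs_of_pos hs0]
          exact (min_le_left _ _).trans_lt (by linarith))
        rwa [abs_of_pos hs0] at this
      obtain ⟨ξ, hξ, hξe⟩ := exists_hasDerivAt_eq_slope d D hs0
        (hdc.mono (Icc_subset_Icc le_rfl (hst.le.trans ht.2))) (fun x hx => hd x hx.1)
      have hDξ : |D ξ| ≤ ε := by
        rw [hξe, h0, sub_zero, sub_zero, abs_div, abs_of_pos hs0, div_le_iff₀ hs0]
        exact hds
      have hξt : ξ < t := hξ.2.trans hst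
      have hwξ : w ξ ≤ w t := hmono _ _ (by
        rw [abs_of_pos hξ.1, abs_of_pos ht.1]; exact hξt.le)
      have hmv := norm_image_sub_le_of_norm_deriv_le_segment' (f := fun s => w s * D s)
        (f' := fun s => -(μ * w s * d s)) (a := ξ) (b := t) (C := |μ| * (w t * B t))
        (fun x hx => (hode x (hξ.1.trans_le hx.1)).hasDerivWithinAt)
        (fun x hx => by
          have hx0 : 0 < x := hξ.1.trans_le hx.1
          have hwx : w x ≤ w t := hmono _ _ (by
            rw [abs_of_pos hx0, abs_of_pos ht.1]; exact hx.2.le)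
          rw [Real.norm_eq_abs, abs_neg, mul_assoc, abs_mul, abs_mul,
            abs_of_pos (hpos x hx0.ne')]
          refine mul_le_mul_of_nonneg_left ?_ (abs_nonneg μ)
          exact mul_le_mul hwx ((hdB x ⟨hx0.le, hx.2.le.trans ht.2⟩).trans
            (hB x t hx0.le hx.2.le)) (abs_nonneg _) hwt.le) t ⟨hξt.le, le_rfl⟩
      rw [Real.norm_eq_abs] at hmv
      have h1 : |w t * D t| ≤ |w t * D t - w ξ * D ξ| + |w ξ * D ξ| := by
        have := abs_add_le (w t * D t - w ξ * D ξ) (w ξ * D ξ)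
        rwa [sub_add_cancel] at this
      have h2 : |w ξ * D ξ| ≤ w t * ε := by
        rw [abs_mul, abs_of_pos (hpos ξ hξ.1.ne')]
        exact mul_le_mul hwξ hDξ (abs_nonneg _) hwt.le
      rw [abs_mul (w t), abs_of_pos hwt] at h1
      have h3 : |μ| * (w t * B t) * (t - ξ) ≤ |μ| * (w t * B t) * t :=
        mul_le_mul_of_nonneg_left (by linarith [hξ.1]) (by positivity)
      linarith
    refine le_of_forall_pos_le_add fun ε hε => ?_
    have := main ε hε
    refine le_of_mul_le_mul_left (a := w t) ?_ hwt
    linarith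
  have iter : ∀ k : ℕ, ∀ t ∈ Icc 0 T, |d t| ≤ (M * |μ| ^ k) * ((t ^ 2) ^ k / k.factorial) := by
    intro k
    induction k with
    | zero => intro t ht; simpa using hM t ht
    | succ k ih =>
      have hst := step (fun t => (M * |μ| ^ k) * ((t ^ 2) ^ k / k.factorial))
        (fun s t hs hst => by gcongr) ih
      set D' : ℝ → ℝ := fun t => if t = 0 then 0 else D t with hD'
      refine bound_of_deriv_bound (F := d) (F' := D') k _ (by positivity) T h0 hdc ?_ ?_
      · intro t ht
        rcases ht.1.eq_or_lt with h | h
        · rw [← h]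
          simpa [hD'] using hd0.hasDerivWithinAt
        · simpa [hD', h.ne'] using (hd t h).hasDerivWithinAt
      · intro t ht
        rcases ht.1.eq_or_lt with h | h
        · rw [← h]; simp [hD']
        · simp only [hD', h.ne', if_false]
          refine (hst t ⟨h, ht.2.le⟩).trans (le_of_eq ?_)
          ring
  have hlim : Tendsto (fun k : ℕ => M * ((|μ| * T ^ 2) ^ k / k.factorial)) atTop (𝓝 0) := by
    simpa using (FloorSemiring.tendsto_pow_div_factorial_atTop (|μ| * T ^ 2)).const_mul M
  have hle : |d T| ≤ 0 := ge_of_tendsto' hlim fun k => by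
    refine (iter k T ⟨hT.le, le_rfl⟩).trans (le_of_eq ?_)
    rw [mul_pow]; ring
  exact abs_eq_zero.1 (le_antisymm hle (abs_nonneg _))

theorem weight_aux {α β : ℝ} (hβ : -1 / 2 ≤ β) (hα : -1 / 2 < α) :
    Continuous (fun t => jacobiWeight α β |t|) ∧ (∀ t, t ≠ 0 → 0 < jacobiWeight α β |t|) ∧
      (∀ s t, |s| ≤ |t| → jacobiWeight α β |s| ≤ jacobiWeight α β |t|) ∧
      0 ≤ jacobiWeight α β |0| := by
  have ha : 0 < 2 * α + 1 := by linarith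
  have hb : 0 ≤ 2 * β + 1 := by linarith
  refine ⟨?_, ?_, ?_, ?_⟩
  · unfold jacobiWeight
    refine (continuous_const.mul ?_).mul ?_
    · exact (Real.continuous_rpow_const ha.le).comp (Real.continuous_sinh.comp continuous_abs)
    · exact (Real.continuous_rpow_const hb).comp (Real.continuous_cosh.comp continuous_abs)
  · intro t ht
    have h1 : 0 < Real.sinh |t| := Real.sinh_pos_iff.2 (abs_pos.2 ht)
    have h2 := Real.cosh_pos |t|
    unfold jacobiWeight
    positivity
  · intro s t hst
    have h1 : 0 ≤ Real.sinh |s| := Real.sinh_nonneg_iff.2 (abs_nonneg s)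
    have h2 := Real.cosh_pos |s|
    have h3 : Real.sinh |s| ≤ Real.sinh |t| := Real.sinh_le_sinh.2 hst
    have h4 : Real.cosh |s| ≤ Real.cosh |t| := Real.cosh_le_cosh.2 (by simpa using hst)
    unfold jacobiWeight
    have := h1.trans h3
    gcongr
  · simp [jacobiWeight, Real.zero_rpow ha.ne']

end JacobiAux

/-- The Sturm–Liouville problem has a solution, and `jacobiPhi` is one. -/
theorem jacobiPhi_spec {α β : ℝ} (hβ : -1 / 2 ≤ β) (hα : -1 / 2 < α) (lam : ℝ) :
    IsJacobiFunction α β lam (jacobiPhi α β lam) := by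
  obtain ⟨h1, h2, h3, h4⟩ := JacobiAux.weight_aux hβ hα
  obtain ⟨f, D, he, hf0, hd, hD0, ho⟩ := JacobiAux.exists_solution h1 h2 h3 h4
    (lam ^ 2 + jacobiRho α β ^ 2)
  refine Classical.epsilon_spec (p := IsJacobiFunction α β lam)
    ⟨f, he, hf0, by simpa [hD0] using hd 0, fun t _ => (hd t).differentiableAt, fun t ht => ?_⟩
  have h := ho t ht
  rw [abs_of_pos ht] at h
  refine h.congr_of_eventuallyEq ?_
  filter_upwards [lt_mem_nhds ht] with s hs
  rw [(hd s).deriv, abs_of_pos hs]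

/-- The solution of the Sturm–Liouville problem is unique. -/
theorem IsJacobiFunction.eq_jacobiPhi {α β lam : ℝ} (hβ : -1 / 2 ≤ β) (hα : -1 / 2 < α)
    {φ : ℝ → ℝ} (h : IsJacobiFunction α β lam φ) : φ = jacobiPhi α β lam := by
  obtain ⟨_, h2, h3, _⟩ := JacobiAux.weight_aux hβ hα
  have g := jacobiPhi_spec hβ hα lam
  have key := JacobiAux.unique_solution h2 h3 (lam ^ 2 + jacobiRho α β ^ 2)
    (d := fun t => φ t - jacobiPhi α β lam t)
    (D := fun t => deriv φ t - deriv (jacobiPhi α β lam) t)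
    (by simp [h.map_zero, g.map_zero])
    ((h.deriv_zero.sub g.deriv_zero).congr_deriv (sub_zero 0))
    (fun t ht => (h.differentiable t ht).hasDerivAt.sub (g.differentiable t ht).hasDerivAt)
    (fun t ht => by
      have e := (h.ode t ht).sub (g.ode t ht)
      refine (e.congr_of_eventuallyEq ?_).congr_deriv ?_
      · filter_upwards [lt_mem_nhds ht] with s hs
        simp only [abs_of_pos hs, Pi.sub_apply]
        ring
      · rw [abs_of_pos ht]; ring)
  funext t
  rcases lt_trichotomy t 0 with ht | ht | ht
  · rw [← h.even, ← g.even]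
    exact sub_eq_zero.1 (key (-t) (by linarith))
  · rw [ht, h.map_zero, g.map_zero]
  · exact sub_eq_zero.1 (key t ht)

/-- The normalized Jacobi function `ψ_lam(t) = φ_lam(t) / φ_0(t)`. -/
noncomputable def jacobiPsi (α β lam t : ℝ) : ℝ := jacobiPhi α β lam t / jacobiPhi α β 0 t

/-- The elements of a set `S` of reals listed in increasing order: the least element, the least
element above that one, and so on, see `nthSmallest_eq`. -/
noncomputable def nthSmallest (S : Set ℝ) : ℕ → ℝ
  | 0 => sInf S
  | k + 1 => sInf {x | x ∈ S ∧ nthSmallest S k < x}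

/-- If `S` is the set of values of a strictly increasing sequence, `nthSmallest S` is it. -/
theorem nthSmallest_eq {S : Set ℝ} {l : ℕ → ℝ} (hl : StrictMono l) (hS : Set.range l = S) :
    nthSmallest S = l := by
  subst hS
  funext k
  induction k with
  | zero =>
    refine IsLeast.csInf_eq ⟨⟨0, rfl⟩, ?_⟩
    rintro _ ⟨j, rfl⟩
    exact hl.monotone (Nat.zero_le j)
  | succ k ih =>
    refine IsLeast.csInf_eq ⟨⟨⟨k + 1, rfl⟩, ?_⟩, ?_⟩
    · rw [ih]; exact hl (Nat.lt_succ_self k)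
    · rintro _ ⟨⟨j, rfl⟩, hj⟩
      rw [ih] at hj
      exact hl.monotone (hl.lt_iff_lt.1 hj)

/-- `jacobiZero α β τ k` is `λ_{k+1}(τ)`: the positive zeros `λ_1(τ) < λ_2(τ) < ⋯` of
`lam ↦ φ_lam(τ)`, numbered here from `k = 0`. -/
noncomputable def jacobiZero (α β τ : ℝ) (k : ℕ) : ℝ :=
  nthSmallest {lam | 0 < lam ∧ jacobiPhi α β lam τ = 0} k

/-- `jacobiZeroStar α β τ k` is `λ*_{k+1}(τ)`: the positive zeros `λ*_1(τ) < λ*_2(τ) < ⋯` of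
`lam ↦ ψ'_lam(τ)` (derivative in the variable `t`), numbered here from `k = 0`. -/
noncomputable def jacobiZeroStar (α β τ : ℝ) (k : ℕ) : ℝ :=
  nthSmallest {lam | 0 < lam ∧ deriv (jacobiPsi α β lam) τ = 0} k

/-- The multiplicity of `t` as a zero of `p`: the supremum of the `m` such that
`p, p', …, p^{(m-1)}` vanish at `t` (so it is `0` where `p` does not vanish). -/
noncomputable def zeroMultiplicity (p : ℝ → ℝ) (t : ℝ) : ℕ∞ :=
  ⨆ (m : ℕ) (_ : ∀ j < m, iteratedDeriv j p t = 0), (m : ℕ∞)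

open Classical in
/-- The contribution of the point `t` of the interval `I` to the number of zeros of `p`:
zeros in the interior of `I` count with multiplicity, a zero at an endpoint counts once. -/
noncomputable def zeroWeight (I : Set ℝ) (p : ℝ → ℝ) (t : ℝ) : ℕ∞ :=
  if t ∈ interior I then zeroMultiplicity p t else if p t = 0 then 1 else 0

/-- The number `N_I(p)` of zeros of `p` on the interval `I`. -/
noncomputable def zeroCount (I : Set ℝ) (p : ℝ → ℝ) : ℕ∞ :=
  ⨆ (F : Finset ℝ) (_ : (F : Set ℝ) ⊆ I), ∑ t ∈ F, zeroWeight I p t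

/-- `f 0, f 1, …` is a Chebyshev system on `I`: every nontrivial linear combination `p` of the
first `n` functions satisfies `N_I(p) ≤ n - 1`, that is `N_I(p) < n`. -/
def IsChebyshevSystem (f : ℕ → ℝ → ℝ) (I : Set ℝ) : Prop :=
  ∀ (n : ℕ) (A : ℕ → ℝ), (∃ k < n, A k ≠ 0) →
    zeroCount I (fun t => ∑ k ∈ Finset.range n, A k * f k t) < (n : ℕ∞)

/-- The family `{1} ∪ {f 0, f 1, …}`, in this order. -/
def consOne (f : ℕ → ℝ → ℝ) : ℕ → ℝ → ℝ
  | 0 => fun _ => 1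
  | k + 1 => f k

/-! The functions `ψ_λ` solve `(w ψ')' + λ² w ψ = 0` with `w = Δ φ_0²`, so `L f = w⁻¹ (w f')'`
multiplies `ψ_λ` by `-λ²` and kills constants. The argument is Sturm's: a zero count for `p = C +
∑_{k ≤ q} A_k ψ_{x_k}`, `A_q ≠ 0`, is carried over to its dominant term.

Applying `L` loses no zeros. Each of its two differentiations costs one zero by Rolle's theorem
(`ZeroSeq.rolle`), and the boundary conditions pay it back: the fluxes `w ψ'` vanish at `0`, and at
`τ` either all `ψ_{x_k}` or all fluxes vanish. Multiplicities are measured by the vanishing of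
successive quasi-derivatives, which lets Rolle's theorem be iterated as a statement on lists of
points.

As `j → ∞`, `L^j p / (-x_q²)^j` tends to `A_q ψ_{x_q}`. The zeros of `ψ_{x_q}` on `(0, τ]` are
simple, so zeros of `L^j p` cannot merge in the limit, and `ψ_{x_q}` inherits their number as
distinct zeros (`hasDistinctZeros_of_chain`).

This number is bounded by Sturm oscillation (`le_encard_of_hasDistinctZeros`): as the parameter
grows from `0`, zeros of `ψ_λ` or of its flux enter `(0, τ]` only through `τ`, and each entry is a
parameter whose function vanishes at `τ`. Up to `x_q` there are `q + 1` of these, which contradicts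
too many zeros of `p`.

All this works for any nondecreasing weight that is positive and smooth on `(0, ∞)`. The Jacobi
input is `slFamily_jacobiPsi`: `φ_0 > 0` and `Δ φ_0²` is nondecreasing, both consequences of `Δ'/Δ ≥
2ρ`. -/

open Filter Topology Set
open scoped ContDiff

/-! ### Rolle's theorem along a chain of quasi-derivatives. -/

namespace SturmChain

/-- A sequence of functions each of which is, up to a nonvanishing smooth factor, the derivative
of its predecessor on `(0, ∞)`. -/
structure IsChain (R c : ℕ → ℝ → ℝ) : Prop where
  cont : ∀ i, Continuous (R i)
  deriv : ∀ i s, 0 < s → HasDerivAt (R i) (c i s * R (i + 1) s) s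
  ne : ∀ i s, 0 < s → c i s ≠ 0
  smooth : ∀ i, ContDiffOn ℝ ∞ (c i) (Ioi 0)

/-- `t 0 ≤ ⋯ ≤ t (N - 1)` are zeros of `R i` on `[0, τ]`, listed with multiplicities measured
along the chain; the endpoints may occur at most once. -/
structure ZeroSeq (R : ℕ → ℝ → ℝ) (τ : ℝ) (i N : ℕ) (t : ℕ → ℝ) : Prop where
  mono : ∀ k l, k ≤ l → l < N → t k ≤ t l
  mem : ∀ k < N, t k ∈ Icc 0 τ
  simple : ∀ k l, k < l → l < N → t k = t l → t k ∈ Ioo 0 τ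
  zero : ∀ k j, k + j < N → t k = t (k + j) → R (i + j) (t k) = 0

/-- `R i` has `N` zeros in `(0, τ)`, counted with multiplicities along the chain. -/
def HasInteriorZeros (R : ℕ → ℝ → ℝ) (τ : ℝ) (i N : ℕ) : Prop :=
  ∃ t, ZeroSeq R τ i N t ∧ ∀ k < N, t k ∈ Ioo 0 τ

variable {R c : ℕ → ℝ → ℝ} {τ : ℝ} {i N : ℕ} {t : ℕ → ℝ}

theorem ZeroSeq.take (h : ZeroSeq R τ i N t) {M : ℕ} (hM : M ≤ N) : ZeroSeq R τ i M t :=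
  ⟨fun k l hkl hl => h.mono k l hkl (hl.trans_le hM), fun k hk => h.mem k (hk.trans_le hM),
    fun k l hkl hl => h.simple k l hkl (hl.trans_le hM),
    fun k j hkj => h.zero k j (hkj.trans_le hM)⟩

/-- Rolle's theorem with multiplicities. -/
theorem ZeroSeq.rolle (hR : IsChain R c) (h : ZeroSeq R τ i (N + 1) t) :
    HasInteriorZeros R τ (i + 1) N := by
  -- A repeated zero is kept, and a genuine gap contributes a point strictly inside it. The last
  -- clause records that touching an end of the gap means the gap is degenerate.
  have key : ∀ k, ∃ s, k < N → s ∈ Ioo 0 τ ∧ t k ≤ s ∧ s ≤ t (k + 1) ∧ R (i + 1) s = 0 ∧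
      (s = t k ∨ s = t (k + 1) → t k = t (k + 1)) := by
    intro k
    by_cases hk : k < N
    · rcases (h.mono k (k + 1) (by omega) (by omega)).eq_or_lt with he | hlt
      · exact ⟨t k, fun _ => ⟨h.simple k (k + 1) (by omega) (by omega) he, le_rfl, he.le,
          h.zero k 1 (by omega) he, fun _ => he⟩⟩
      · have h0 := (h.mem k (by omega)).1
        have h1 := (h.mem (k + 1) (by omega)).2
        obtain ⟨s, hs, hs0⟩ := exists_hasDerivAt_eq_zero hlt (hR.cont i).continuousOn
          ((h.zero k 0 (by omega) rfl).trans (h.zero (k + 1) 0 (by omega) rfl).symm)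
          (fun x hx => hR.deriv i x (h0.trans_lt hx.1))
        have hs1 : 0 < s := h0.trans_lt hs.1
        refine ⟨s, fun _ => ⟨⟨hs1, hs.2.trans_le h1⟩, hs.1.le, hs.2.le,
          (mul_eq_zero.1 hs0).resolve_left (hR.ne i s hs1), ?_⟩⟩
        rintro (e | e)
        · exact absurd e hs.1.ne'
        · exact absurd e hs.2.ne
    · exact ⟨0, fun h => absurd h hk⟩
  choose s hs using key
  refine ⟨s, ⟨?_, fun k hk => Ioo_subset_Icc_self (hs k hk).1, fun k l hkl hl _ =>
    (hs k (hkl.trans hl)).1, ?_⟩, fun k hk => (hs k hk).1⟩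
  · intro k l hkl hl
    rcases hkl.eq_or_lt with rfl | hlt
    · exact le_rfl
    · exact ((hs k (hlt.trans hl)).2.2.1.trans (h.mono (k + 1) l hlt (by omega))).trans
        (hs l hl).2.1
  · intro k j hkj he
    rcases Nat.eq_zero_or_pos j with rfl | hj
    · exact (hs k (by omega)).2.2.2.1
    · obtain ⟨-, a1, a2, -, a3⟩ := hs k (by omega)
      obtain ⟨-, b1, b2, -, b3⟩ := hs (k + j) hkj
      -- Equality of `s k` and `s (k + j)` squeezes all entries in between to one point. The
      -- degeneracy clause adds the two outer entries, so `j + 1` equal points `s` come from `j + 2`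
      -- equal points `t`: differentiation lowers the multiplicity by exactly one.
      have m := h.mono (k + 1) (k + j) (by omega) (by omega)
      have e1 : s k = t (k + 1) := le_antisymm a2 (by rw [he]; exact m.trans b1)
      have e2 : s (k + j) = t (k + j) := le_antisymm (by rw [← he]; exact a2.trans m) b1
      have e3 := a3 (Or.inr e1)
      have e4 := b3 (Or.inl e2)
      have e5 : t k = t (k + (j + 1)) := by
        rw [← add_assoc, ← e4, ← e2, ← he, e1, e3]
      have := h.zero k (j + 1) (by omega) e5
      rw [e1, ← e3]
      rwa [add_assoc, add_comm 1 j]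

theorem ZeroSeq.append (hτ : 0 < τ) (h : ZeroSeq R τ i N t) (ht : ∀ k < N, t k < τ)
    (hz : R i τ = 0) : ZeroSeq R τ i (N + 1) (fun k => if k < N then t k else τ) := by
  refine ⟨?_, ?_, ?_, ?_⟩
  · intro k l hkl hl
    by_cases h1 : l < N
    · simpa [h1, hkl.trans_lt h1] using h.mono k l hkl h1
    · by_cases h2 : k < N
      · simpa [h1, h2] using (ht k h2).le
      · simp [h1, h2]
  · intro k _
    by_cases h2 : k < N
    · simpa [h2] using h.mem k h2
    · simp [h2, hτ.le]
  · intro k l hkl hl he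
    have h2 : k < N := by omega
    by_cases h1 : l < N
    · simp only [h1, h2, if_true] at he ⊢
      exact h.simple k l hkl h1 he
    · simp only [h1, h2, if_true, if_false] at he
      exact absurd he (ht k h2).ne
  · intro k j hkj he
    by_cases h1 : k + j < N
    · have h2 : k < N := by omega
      simp only [h1, h2, if_true] at he ⊢
      exact h.zero k j h1 he
    · by_cases h2 : k < N
      · simp only [h1, h2, if_true, if_false] at he
        exact absurd he (ht k h2).ne
      · obtain rfl : j = 0 := by omega
        simpa [h2] using hz

theorem ZeroSeq.prepend (hτ : 0 < τ) (h : ZeroSeq R τ i N t) (ht : ∀ k < N, 0 < t k)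
    (hz : R i 0 = 0) : ZeroSeq R τ i (N + 1) (fun k => if k = 0 then 0 else t (k - 1)) := by
  refine ⟨?_, ?_, ?_, ?_⟩
  · intro k l hkl hl
    by_cases h1 : k = 0
    · by_cases h2 : l = 0
      · simp [h1, h2]
      · simpa [h1, h2] using (ht (l - 1) (by omega)).le
    · have h2 : l ≠ 0 := by omega
      simpa [h1, h2] using h.mono (k - 1) (l - 1) (by omega) (by omega)
  · intro k hk
    by_cases h1 : k = 0
    · simp [h1, hτ.le]
    · simpa [h1] using h.mem (k - 1) (by omega)
  · intro k l hkl hl he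
    have h2 : l ≠ 0 := by omega
    by_cases h1 : k = 0
    · simp only [h1, h2, if_true, if_false] at he
      exact absurd he (ht (l - 1) (by omega)).ne
    · simp only [h1, h2, if_false] at he ⊢
      exact h.simple (k - 1) (l - 1) (by omega) (by omega) he
  · intro k j hkj he
    by_cases h1 : k = 0
    · subst h1
      rcases Nat.eq_zero_or_pos j with rfl | hj
      · simpa using hz
      · have h2 : 0 + j ≠ 0 := by omega
        simp only [h2, if_true, if_false] at he
        exact absurd he (ht (0 + j - 1) (by omega)).ne
    · have h2 : k + j ≠ 0 := by omega
      simp only [h1, h2, if_false] at he ⊢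
      have e : k + j - 1 = k - 1 + j := by omega
      rw [e] at he
      exact h.zero (k - 1) j (by omega) he

/-- A zero at an endpoint offsets the zero lost to Rolle's theorem. With zeros at both endpoints, as
in `succ_both`, one zero is gained. -/
theorem HasInteriorZeros.succ_right (hR : IsChain R c) (hτ : 0 < τ)
    (h : HasInteriorZeros R τ i N) (hz : R i τ = 0) : HasInteriorZeros R τ (i + 1) N := by
  obtain ⟨t, ht, hm⟩ := h
  exact (ht.append hτ (fun k hk => (hm k hk).2) hz).rolle hR

theorem HasInteriorZeros.succ_left (hR : IsChain R c) (hτ : 0 < τ)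
    (h : HasInteriorZeros R τ i N) (hz : R i 0 = 0) : HasInteriorZeros R τ (i + 1) N := by
  obtain ⟨t, ht, hm⟩ := h
  exact (ht.prepend hτ (fun k hk => (hm k hk).1) hz).rolle hR

theorem HasInteriorZeros.succ_both (hR : IsChain R c) (hτ : 0 < τ)
    (h : HasInteriorZeros R τ i N) (hz : R i 0 = 0) (hz' : R i τ = 0) :
    HasInteriorZeros R τ (i + 1) (N + 1) := by
  obtain ⟨t, ht, hm⟩ := h
  refine ((ht.append hτ (fun k hk => (hm k hk).2) hz').prepend hτ ?_ hz).rolle hR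
  intro k _
  by_cases hk : k < N
  · simpa [hk] using (hm k hk).1
  · simpa [hk] using hτ

/-! ### Ordinary multiplicities compared with multiplicities along the chain. -/

theorem IsChain.contDiffOn (hR : IsChain R c) (i : ℕ) : ContDiffOn ℝ ∞ (R i) (Ioi 0) := by
  have key : ∀ (n i : ℕ), ContDiffOn ℝ n (R i) (Ioi 0) := by
    intro n
    induction n with
    | zero => exact fun i => contDiffOn_zero.2 (hR.cont i).continuousOn
    | succ n ih =>
      intro i
      rw [Nat.cast_succ, contDiffOn_succ_iff_deriv_of_isOpen isOpen_Ioi]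
      refine ⟨fun x hx => (hR.deriv i x hx).differentiableAt.differentiableWithinAt,
        fun h => absurd h (by simp), ?_⟩
      exact ((contDiffOn_infty.1 (hR.smooth i) n).mul (ih (i + 1))).congr
        fun x hx => (hR.deriv i x hx).deriv
  exact contDiffOn_infty.2 fun n => key n i

theorem iteratedDeriv_mul_eq_zero {f g : ℝ → ℝ} {a : ℝ} {m : ℕ} (hf : ContDiffAt ℝ ∞ f a)
    (hg : ContDiffAt ℝ ∞ g a) (h : ∀ j < m, iteratedDeriv j g a = 0) :
    ∀ j < m, iteratedDeriv j (fun x => f x * g x) a = 0 := by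
  intro j hj
  rw [iteratedDeriv_fun_mul (hf.of_le (by exact_mod_cast le_top))
    (hg.of_le (by exact_mod_cast le_top))]
  refine Finset.sum_eq_zero fun l _ => ?_
  rw [h (j - l) (by omega), mul_zero]

/-- Dividing the derivative by the smooth nonvanishing factor `c i` does not lower the order of
vanishing, by Leibniz's rule. -/
theorem IsChain.iteratedDeriv_succ_eq_zero (hR : IsChain R c) {a : ℝ} (ha : 0 < a) {i m : ℕ}
    (h : ∀ j < m, iteratedDeriv j (_root_.deriv (R i)) a = 0) :
    ∀ j < m, iteratedDeriv j (R (i + 1)) a = 0 := by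
  intro j hj
  have hnhds : Ioi (0 : ℝ) ∈ 𝓝 a := Ioi_mem_nhds ha
  have hev : R (i + 1) =ᶠ[𝓝 a] fun x => (c i x)⁻¹ * _root_.deriv (R i) x := by
    filter_upwards [hnhds] with x hx
    rw [(hR.deriv i x hx).deriv, inv_mul_cancel_left₀ (hR.ne i x hx)]
  have hd : ContDiffAt ℝ ∞ (_root_.deriv (R i)) a := by
    have : ContDiffOn ℝ ∞ (_root_.deriv (R i)) (Ioi 0) :=
      ((hR.smooth i).mul (hR.contDiffOn (i + 1))).congr fun x hx => (hR.deriv i x hx).deriv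
    exact this.contDiffAt hnhds
  have hc : ContDiffAt ℝ ∞ (fun x => (c i x)⁻¹) a :=
    ((hR.smooth i).contDiffAt hnhds).inv (hR.ne i a ha)
  rw [hev.iteratedDeriv_eq]
  exact iteratedDeriv_mul_eq_zero hc hd h j hj

/-- The ordinary multiplicity of a zero is a multiplicity along the chain. -/
theorem IsChain.vanish (hR : IsChain R c) {a : ℝ} (ha : 0 < a) (m : ℕ) :
    ∀ i, (∀ j < m, iteratedDeriv j (R i) a = 0) → ∀ j < m, R (i + j) a = 0 := by
  induction m with
  | zero => intro i _ j hj; omega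
  | succ m ih =>
    intro i h j hj
    rcases Nat.eq_zero_or_pos j with rfl | hj0
    · simpa using h 0 (by omega)
    · have := ih (i + 1) (hR.iteratedDeriv_succ_eq_zero ha fun q hq => by
        rw [← iteratedDeriv_succ']
        exact h (q + 1) (by omega)) (j - 1) (by omega)
      rwa [add_assoc, Nat.add_sub_cancel' hj0] at this

/-- Rolle's theorem between consecutive zeros of a sequence. -/
theorem ZeroSeq.exists_zero_between (hR : IsChain R c) (h : ZeroSeq R τ i N t) {k : ℕ}
    (hk : k + 1 < N) : ∃ s ∈ Icc (t k) (t (k + 1)), R (i + 1) s = 0 := by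
  rcases (h.mono k (k + 1) (by omega) hk).eq_or_lt with he | hlt
  · exact ⟨t k, ⟨le_rfl, he.le⟩, h.zero k 1 hk he⟩
  · have h0 := (h.mem k (by omega)).1
    obtain ⟨s, hs, hs0⟩ := exists_hasDerivAt_eq_zero hlt (hR.cont i).continuousOn
      ((h.zero k 0 (by omega) rfl).trans (h.zero (k + 1) 0 (by omega) rfl).symm)
      (fun x hx => hR.deriv i x (h0.trans_lt hx.1))
    exact ⟨s, Ioo_subset_Icc_self hs,
      (mul_eq_zero.1 hs0).resolve_left (hR.ne i s (h0.trans_lt hs.1))⟩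

/-- Points with multiplicities listed in increasing order. -/
theorem exists_sorted_list (m : ℝ → ℕ) (F : Finset ℝ) : ∃ t : ℕ → ℝ,
    (∀ k < ∑ x ∈ F, m x, t k ∈ F) ∧ (∀ k l, k ≤ l → l < ∑ x ∈ F, m x → t k ≤ t l) ∧
    ∀ k l, k ≤ l → l < ∑ x ∈ F, m x → t k = t l → l - k < m (t k) := by
  induction F using Finset.induction_on_max with
  | empty => exact ⟨fun _ => 0, by simp, by simp, by simp⟩
  | insert a F ha ih =>
    obtain ⟨t, h1, h2, h3⟩ := ih
    have hsum : ∑ x ∈ insert a F, m x = m a + ∑ x ∈ F, m x :=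
      Finset.sum_insert fun h => lt_irrefl a (ha a h)
    rw [hsum]
    refine ⟨fun k => if k < ∑ x ∈ F, m x then t k else a, ?_, ?_, ?_⟩
    · intro k _
      by_cases hk' : k < ∑ x ∈ F, m x
      · simp only [hk', if_true]
        exact Finset.mem_insert_of_mem (h1 k hk')
      · simp [hk']
    · intro k l hkl hl
      by_cases hl' : l < ∑ x ∈ F, m x
      · simpa only [hl', hkl.trans_lt hl', if_true] using h2 k l hkl hl'
      · by_cases hk' : k < ∑ x ∈ F, m x
        · simpa only [hl', hk', if_true, if_false] using (ha _ (h1 k hk')).le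
        · simp [hk', hl']
    · intro k l hkl hl he
      by_cases hl' : l < ∑ x ∈ F, m x
      · simp only [hl', hkl.trans_lt hl', if_true] at he ⊢
        exact h3 k l hkl hl' he
      · by_cases hk' : k < ∑ x ∈ F, m x
        · simp only [hl', hk', if_true, if_false] at he
          exact absurd he (ha _ (h1 k hk')).ne
        · simp only [hk', if_false]
          omega

/-- Multiplicities may be infinite, whereas a list of zeros needs finite ones, so they are truncated
at `K`. If some weight reaches `K`, that point alone suffices. Otherwise truncation changes nothing.
-/
theorem exists_nat_weights {F : Finset ℝ} {z : ℝ → ℕ∞} {K : ℕ} (h : (K : ℕ∞) ≤ ∑ x ∈ F, z x) :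
    ∃ m : ℝ → ℕ, (∀ x, (m x : ℕ∞) ≤ z x) ∧ K ≤ ∑ x ∈ F, m x := by
  have hne : ∀ x, min (z x) K ≠ ⊤ := fun x =>
    ne_top_of_le_ne_top (ENat.natCast_ne_top K) (min_le_right _ _)
  have hcoe : ∀ x, (((min (z x) K).toNat : ℕ) : ℕ∞) = min (z x) K := fun x =>
    ENat.natCast_toNat (hne x)
  refine ⟨fun x => (min (z x) K).toNat, fun x => (hcoe x).le.trans (min_le_left _ _), ?_⟩
  by_cases hx : ∃ x ∈ F, (K : ℕ∞) ≤ z x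
  · obtain ⟨x, hxF, hxK⟩ := hx
    refine le_trans ?_ (Finset.single_le_sum (fun _ _ => Nat.zero_le _) hxF)
    rw [min_eq_right hxK, ENat.toNat_natCast]
  · push Not at hx
    have : ((∑ x ∈ F, (min (z x) K).toNat : ℕ) : ℕ∞) = ∑ x ∈ F, z x := by
      rw [Nat.cast_sum]
      exact Finset.sum_congr rfl fun x hxF => by rw [hcoe, min_eq_left (hx x hxF).le]
    exact_mod_cast this ▸ h

theorem iteratedDeriv_eq_zero_of_lt_zeroMultiplicity {p : ℝ → ℝ} {a : ℝ} {j : ℕ}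
    (h : (j : ℕ∞) < zeroMultiplicity p a) : iteratedDeriv j p a = 0 := by
  unfold zeroMultiplicity at h
  obtain ⟨m, hm⟩ := lt_iSup_iff.1 h
  obtain ⟨hm', hlt⟩ := lt_iSup_iff.1 hm
  exact hm' j (by exact_mod_cast hlt)

/-- If the zeros of `p` are zeros of `R i`, with multiplicities, and `p` has many of them, they
can be listed. -/
theorem exists_zeroSeq_of_zeroCount {I : Set ℝ} {p : ℝ → ℝ} {M : ℕ} (hI : I ⊆ Icc 0 τ)
    (hint : interior I = Ioo 0 τ)
    (hv : ∀ a ∈ Ioo 0 τ, ∀ m, (∀ j < m, iteratedDeriv j p a = 0) → ∀ j < m, R (i + j) a = 0)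
    (he : ∀ a ∈ I, p a = 0 → R i a = 0) (hM : ¬ zeroCount I p < ((M + 1 : ℕ) : ℕ∞)) :
    ∃ t, ZeroSeq R τ i (M + 1) t ∧ ∀ k < M + 1, t k ∈ I := by
  have hex : ∃ F : Finset ℝ, (F : Set ℝ) ⊆ I ∧ ((M + 1 : ℕ) : ℕ∞) ≤ ∑ x ∈ F, zeroWeight I p x := by
    by_contra! hcon
    refine hM (lt_of_le_of_lt (b := (M : ℕ∞)) (iSup₂_le fun F hF => ?_)
      (by exact_mod_cast Nat.lt_succ_self M))
    have := hcon F hF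
    rw [Nat.cast_succ] at this
    exact Order.lt_add_one_iff_of_not_isMax (by simp) |>.1 this
  obtain ⟨F, hF, hsum⟩ := hex
  obtain ⟨m, hm, hKm⟩ := exists_nat_weights hsum
  obtain ⟨t, h1, h2, h3⟩ := exists_sorted_list m F
  have hmemI : ∀ k < ∑ x ∈ F, m x, t k ∈ I := fun k hk => hF (h1 k hk)
  -- Points of `I` outside the interior are endpoints, where the count allows weight one at most.
  -- This is what the field `simple` asks for.
  have hend : ∀ a, a ∉ Ioo 0 τ → m a ≤ 1 ∧ (0 < m a → p a = 0) := by
    intro a ha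
    have := hm a
    rw [zeroWeight, if_neg (by rwa [hint])] at this
    split_ifs at this with hp
    · exact ⟨by exact_mod_cast this, fun _ => hp⟩
    · have h0 : m a = 0 := by exact_mod_cast nonpos_iff_eq_zero.1 this
      exact ⟨by omega, fun h => by omega⟩
  have hseq : ZeroSeq R τ i (∑ x ∈ F, m x) t := by
    refine ⟨h2, fun k hk => hI (hmemI k hk), ?_, ?_⟩
    · intro k l hkl hl hkl'
      by_contra ha
      have := h3 k l hkl.le hl hkl'
      have := (hend _ ha).1
      omega
    · intro k j hkj hk
      have hj := h3 k (k + j) (by omega) hkj hk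
      rw [Nat.add_sub_cancel_left] at hj
      by_cases ha : t k ∈ Ioo 0 τ
      · refine hv _ ha (m (t k)) (fun q hq => ?_) j hj
        have := hm (t k)
        rw [zeroWeight, if_pos (by rwa [hint])] at this
        exact iteratedDeriv_eq_zero_of_lt_zeroMultiplicity
          (lt_of_lt_of_le (by exact_mod_cast hq) this)
      · obtain ⟨e1, e2⟩ := hend _ ha
        obtain rfl : j = 0 := by omega
        exact he _ (hmemI k (by omega)) (e2 hj)
  exact ⟨t, hseq.take hKm, fun k hk => hmemI k (hk.trans_le hKm)⟩

end SturmChain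

/-! ### Zeros under perturbation, and the oscillation count. -/

namespace SturmChain

/-- `f` has `N` distinct zeros on `(0, τ]`. -/
def HasDistinctZeros (f : ℝ → ℝ) (τ : ℝ) (N : ℕ) : Prop :=
  ∃ t : ℕ → ℝ, (∀ k l, k < l → l < N → t k < t l) ∧ ∀ k < N, t k ∈ Ioc 0 τ ∧ f (t k) = 0

theorem HasDistinctZeros.take {f : ℝ → ℝ} {τ : ℝ} {M N : ℕ} (h : HasDistinctZeros f τ N)
    (hM : M ≤ N) : HasDistinctZeros f τ M := by
  obtain ⟨t, h1, h2⟩ := h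
  exact ⟨t, fun k l hkl hl => h1 k l hkl (hl.trans_le hM), fun k hk => h2 k (hk.trans_le hM)⟩

theorem strictMono_lt_of_succ {t : ℕ → ℝ} {N : ℕ} (h : ∀ k, k + 1 < N → t k < t (k + 1)) :
    ∀ k l, k < l → l < N → t k < t l := by
  intro k l hkl
  induction l, hkl using Nat.le_induction with
  | base => exact fun hl => h k hl
  | succ l hkl ih => exact fun hl => (ih (by omega)).trans (h l hl)

/-- Rolle's theorem for distinct zeros. -/
theorem HasDistinctZeros.rolle {f g : ℝ → ℝ} {τ : ℝ} {N : ℕ}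
    (hfg : ∀ a b, 0 < a → a < b → f a = 0 → f b = 0 → ∃ s ∈ Ioo a b, g s = 0)
    (h : HasDistinctZeros f τ (N + 1)) :
    ∃ t : ℕ → ℝ, (∀ k l, k < l → l < N → t k < t l) ∧ ∀ k < N, t k ∈ Ioo 0 τ ∧ g (t k) = 0 := by
  obtain ⟨t, h1, h2⟩ := h
  have key : ∀ k, ∃ s, k < N → s ∈ Ioo (t k) (t (k + 1)) ∧ g s = 0 := by
    intro k
    by_cases hk : k < N
    · obtain ⟨s, hs⟩ := hfg (t k) (t (k + 1)) (h2 k (by omega)).1.1 (h1 k (k + 1) (by omega)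
        (by omega)) (h2 k (by omega)).2 (h2 (k + 1) (by omega)).2
      exact ⟨s, fun _ => hs⟩
    · exact ⟨0, fun h => absurd h hk⟩
  choose s hs using key
  refine ⟨s, strictMono_lt_of_succ fun k hk =>
    ((hs k (by omega)).1.2).trans (hs (k + 1) hk).1.1, fun k hk => ⟨⟨?_, ?_⟩, (hs k hk).2⟩⟩
  · exact (h2 k (by omega)).1.1.trans (hs k hk).1.1
  · exact (hs k hk).1.2.trans_le (h2 (k + 1) (by omega)).1.2

/-- Zeros of perturbations converge to distinct zeros, if the limit has simple zeros only. -/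
theorem hasDistinctZeros_of_frequently {X : Type*} [TopologicalSpace X] {F G : X → ℝ → ℝ}
    (hF : Continuous (Function.uncurry F)) (hG : Continuous (Function.uncurry G)) {x₀ : X}
    {τ : ℝ} {N : ℕ}
    (hz : ∃ δ > 0, ∀ᶠ x in 𝓝 x₀, ∀ t ∈ Ioo 0 δ, F x t ≠ 0)
    (hne : ∀ t ∈ Ioc 0 τ, F x₀ t = 0 → G x₀ t ≠ 0)
    (h : ∃ᶠ x in 𝓝 x₀, ∃ t : ℕ → ℝ, (∀ k < N, t k ∈ Ioc 0 τ ∧ F x (t k) = 0) ∧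
      ∀ k, k + 1 < N → t k ≤ t (k + 1) ∧ ∃ s ∈ Icc (t k) (t (k + 1)), G x s = 0) :
    HasDistinctZeros (F x₀) τ N := by
  obtain ⟨δ, hδ, hzδ⟩ := hz
  obtain ⟨E, hE⟩ : ∃ E : Set X, E = {x | (∃ t : ℕ → ℝ, (∀ k < N, t k ∈ Ioc 0 τ ∧
      F x (t k) = 0) ∧ ∀ k, k + 1 < N → t k ≤ t (k + 1) ∧
      ∃ s ∈ Icc (t k) (t (k + 1)), G x s = 0) ∧ ∀ t ∈ Ioo 0 δ, F x t ≠ 0} := ⟨_, rfl⟩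
  have hfr : ∃ᶠ x in 𝓝 x₀, x ∈ E := hE ▸ h.and_eventually hzδ
  have hne' : (𝓝 x₀ ⊓ 𝓟 E).NeBot := frequently_mem_iff_neBot.1 hfr
  -- Along an ultrafilter all `N` zeros converge at once by compactness of `[δ, τ]`, without
  -- extracting subsequences. The bound `δ` keeps the limits away from `0`.
  obtain ⟨l, hl⟩ := Ultrafilter.exists_le (𝓝 x₀ ⊓ 𝓟 E)
  have hl0 : (l : Filter X) ≤ 𝓝 x₀ := hl.trans inf_le_left
  have hlp : ∀ᶠ x in (l : Filter X), x ∈ E := (hl.trans inf_le_right) (mem_principal_self _)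
  rw [hE] at hlp
  have hlid : Tendsto id (l : Filter X) (𝓝 x₀) := hl0
  have hch : ∀ x, ∃ t : ℕ → ℝ, ∃ s : ℕ → ℝ, ((∃ t : ℕ → ℝ, (∀ k < N, t k ∈ Ioc 0 τ ∧
      F x (t k) = 0) ∧ ∀ k, k + 1 < N → t k ≤ t (k + 1) ∧ ∃ s ∈ Icc (t k) (t (k + 1)), G x s = 0) →
      (∀ k < N, t k ∈ Ioc 0 τ ∧ F x (t k) = 0) ∧
      ∀ k, k + 1 < N → t k ≤ t (k + 1) ∧ s k ∈ Icc (t k) (t (k + 1)) ∧ G x (s k) = 0) := by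
    intro x
    by_cases hx : ∃ t : ℕ → ℝ, (∀ k < N, t k ∈ Ioc 0 τ ∧
      F x (t k) = 0) ∧ ∀ k, k + 1 < N → t k ≤ t (k + 1) ∧ ∃ s ∈ Icc (t k) (t (k + 1)), G x s = 0
    · obtain ⟨t, h1, h2⟩ := hx
      have : ∀ k, ∃ s, k + 1 < N → s ∈ Icc (t k) (t (k + 1)) ∧ G x s = 0 := by
        intro k
        by_cases hk : k + 1 < N
        · obtain ⟨s, hs⟩ := (h2 k hk).2
          exact ⟨s, fun _ => hs⟩
        · exact ⟨0, fun h => absurd h hk⟩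
      choose s hs using this
      exact ⟨t, s, fun _ => ⟨h1, fun k hk => ⟨(h2 k hk).1, hs k hk⟩⟩⟩
    · exact ⟨fun _ => 0, fun _ => 0, fun h => absurd h hx⟩
  choose t s hts using hch
  have hT : ∀ k, ∃ T, k < N → T ∈ Icc δ τ ∧ Tendsto (fun x => t x k) l (𝓝 T) := by
    intro k
    by_cases hk : k < N
    · obtain ⟨T, hT, hT'⟩ := (isCompact_Icc (a := δ) (b := τ)).ultrafilter_le_nhds
        (l.map fun x => t x k) (by
          rw [le_principal_iff]
          change ∀ᶠ x in (l : Filter X), t x k ∈ Icc δ τ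
          filter_upwards [hlp] with x hx
          have := (hts x hx.1).1 k hk
          refine ⟨?_, this.1.2⟩
          by_contra! hlt
          exact hx.2 _ ⟨this.1.1, hlt⟩ this.2)
      exact ⟨T, fun _ => ⟨hT, hT'⟩⟩
    · exact ⟨0, fun h => absurd h hk⟩
  choose T hT using hT
  have hlim : ∀ k < N, F x₀ (T k) = 0 := by
    intro k hk
    have h1 : Tendsto (fun x => F x (t x k)) l (𝓝 (F x₀ (T k))) :=
      (hF.tendsto (x₀, T k)).comp (hlid.prodMk_nhds (hT k hk).2)
    refine tendsto_nhds_unique (h1.congr' ?_) tendsto_const_nhds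
    filter_upwards [hlp] with x hx
    exact ((hts x hx.1).1 k hk).2
  refine ⟨T, strictMono_lt_of_succ fun k hk => ?_, fun k hk =>
    ⟨⟨hδ.trans_le (hT k hk).1.1, (hT k hk).1.2⟩, hlim k hk⟩⟩
  have hk' : k < N := by omega
  have hle : T k ≤ T (k + 1) := le_of_tendsto_of_tendsto (hT k hk').2 (hT (k + 1) hk).2 (by
    filter_upwards [hlp] with x hx
    exact ((hts x hx.1).2 k hk).1)
  -- If two consecutive limits coincided, the zero of `G x` between the two zeros would converge to
  -- the same point, where `F x₀` and `G x₀` would both vanish.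
  refine hle.lt_of_ne fun he => hne (T k) ⟨hδ.trans_le (hT k hk').1.1, (hT k hk').1.2⟩
    (hlim k hk') ?_
  have hs : Tendsto (fun x => s x k) l (𝓝 (T k)) := by
    refine tendsto_of_tendsto_of_tendsto_of_le_of_le' (hT k hk').2 (he ▸ (hT (k + 1) hk).2) ?_ ?_
    · filter_upwards [hlp] with x hx
      exact ((hts x hx.1).2 k hk).2.1.1
    · filter_upwards [hlp] with x hx
      exact ((hts x hx.1).2 k hk).2.1.2
  have h1 : Tendsto (fun x => G x (s x k)) l (𝓝 (G x₀ (T k))) :=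
    (hG.tendsto (x₀, T k)).comp (hlid.prodMk_nhds hs)
  refine tendsto_nhds_unique (h1.congr' ?_) tendsto_const_nhds
  filter_upwards [hlp] with x hx
  exact ((hts x hx.1).2 k hk).2.2

/-- Simple zeros in the open interval persist under perturbations. -/
theorem eventually_hasDistinctZeros {F : ℝ → ℝ → ℝ} (hF : Continuous (Function.uncurry F))
    {x₀ τ : ℝ} {N : ℕ} {t : ℕ → ℝ} (hmono : ∀ k l, k < l → l < N → t k < t l)
    (ht : ∀ k < N, t k ∈ Ioo 0 τ ∧ F x₀ (t k) = 0)
    (hd : ∀ s ∈ Ioo 0 τ, F x₀ s = 0 → ∃ c ≠ 0, HasDerivAt (F x₀) c s) :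
    ∀ᶠ x in 𝓝 x₀, HasDistinctZeros (F x) τ N := by
  have hε : ∀ᶠ ε : ℝ in 𝓝[>] 0, ∀ k ∈ Finset.range N,
      F x₀ (t k - ε) * F x₀ (t k + ε) < 0 ∧ 0 < t k - ε ∧ t k + ε < τ ∧
      (k + 1 < N → t k + ε < t (k + 1) - ε) := by
    rw [eventually_all_finset]
    intro k hk
    rw [Finset.mem_range] at hk
    obtain ⟨⟨h0, h1⟩, hz⟩ := ht k hk
    obtain ⟨c, hc, hder⟩ := hd (t k) ⟨h0, h1⟩ hz
    -- Near a simple zero the difference quotient has the sign of `c`, so `F x₀` changes sign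
    -- between `t k - ε` and `t k + ε`. This survives small changes of the parameter, and the
    -- intermediate value theorem then gives a zero in each of the disjoint intervals.
    have hslope : ∀ᶠ s in 𝓝[≠] (t k), 0 < slope (F x₀) (t k) s * c :=
      ((hasDerivAt_iff_tendsto_slope.1 hder).mul_const c).eventually_const_lt
        (mul_self_pos.2 hc)
    have hpos : ∀ᶠ ε : ℝ in 𝓝[>] 0, 0 < ε := self_mem_nhdsWithin
    have hplus : Tendsto (fun ε : ℝ => t k + ε) (𝓝[>] 0) (𝓝[≠] (t k)) := by
      refine tendsto_nhdsWithin_iff.2 ⟨?_, ?_⟩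
      · have : Tendsto (fun ε : ℝ => t k + ε) (𝓝 0) (𝓝 (t k + 0)) :=
          (continuous_const.add continuous_id).tendsto 0
        rw [add_zero] at this
        exact this.mono_left nhdsWithin_le_nhds
      · filter_upwards [hpos] with ε hε
        simp [hε.ne']
    have hminus : Tendsto (fun ε : ℝ => t k - ε) (𝓝[>] 0) (𝓝[≠] (t k)) := by
      refine tendsto_nhdsWithin_iff.2 ⟨?_, ?_⟩
      · have : Tendsto (fun ε : ℝ => t k - ε) (𝓝 0) (𝓝 (t k - 0)) :=
          (continuous_const.sub continuous_id).tendsto 0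
        rw [sub_zero] at this
        exact this.mono_left nhdsWithin_le_nhds
      · filter_upwards [hpos] with ε hε
        simp [hε.ne']
    have hgap : ∀ᶠ ε : ℝ in 𝓝[>] 0, k + 1 < N → t k + ε < t (k + 1) - ε := by
      by_cases hk1 : k + 1 < N
      · have hlt := hmono k (k + 1) (by omega) hk1
        filter_upwards [Ioo_mem_nhdsGT (show (0 : ℝ) < (t (k + 1) - t k) / 2 by linarith)]
          with ε hε _
        linarith [hε.2]
      · exact Eventually.of_forall fun _ h => absurd h hk1
    filter_upwards [hplus.eventually hslope, hminus.eventually hslope, hpos, hgap,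
      Ioo_mem_nhdsGT h0, Ioo_mem_nhdsGT (show 0 < τ - t k by linarith)] with ε e1 e2 e3 e4 e5 e6
    refine ⟨?_, by linarith [e5.2], by linarith [e6.2], e4⟩
    rw [slope_def_field, hz, sub_zero] at e1 e2
    have a1 : t k + ε - t k = ε := by ring
    have a2 : t k - ε - t k = -ε := by ring
    rw [a1] at e1
    rw [a2] at e2
    have b1 : 0 < F x₀ (t k + ε) * c := by
      have := mul_pos e1 e3
      rwa [div_mul_eq_mul_div, div_mul_cancel₀ _ e3.ne'] at this
    have b2 : F x₀ (t k - ε) * c < 0 := by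
      have := mul_pos e2 e3
      rw [div_neg, neg_mul, neg_mul, div_mul_eq_mul_div, div_mul_cancel₀ _ e3.ne'] at this
      linarith
    by_contra! hcon
    nlinarith [mul_neg_of_neg_of_pos b2 b1, mul_nonneg hcon (mul_self_nonneg c)]
  obtain ⟨ε, hε, hεpos⟩ := (hε.and (self_mem_nhdsWithin : ∀ᶠ ε : ℝ in 𝓝[>] 0, 0 < ε)).exists
  have hx : ∀ᶠ x in 𝓝 x₀, ∀ k ∈ Finset.range N, F x (t k - ε) * F x (t k + ε) < 0 := by
    rw [eventually_all_finset]
    intro k hk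
    have : Continuous fun x => F x (t k - ε) * F x (t k + ε) :=
      (hF.comp (continuous_id.prodMk continuous_const)).mul
        (hF.comp (continuous_id.prodMk continuous_const))
    exact this.continuousAt.eventually_lt continuousAt_const (hε k hk).1
  filter_upwards [hx] with x hx
  have key : ∀ k, ∃ s, k < N → s ∈ Icc (t k - ε) (t k + ε) ∧ F x s = 0 := by
    intro k
    by_cases hk : k < N
    · have hlt := hx k (Finset.mem_range.2 hk)
      have hcont : ContinuousOn (F x) (uIcc (t k - ε) (t k + ε)) :=
        (hF.comp (continuous_const.prodMk continuous_id)).continuousOn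
      have h0 : (0 : ℝ) ∈ uIcc (F x (t k - ε)) (F x (t k + ε)) := by
        rw [mem_uIcc]
        rcases mul_neg_iff.1 hlt with h | h
        · exact Or.inr ⟨h.2.le, h.1.le⟩
        · exact Or.inl ⟨h.1.le, h.2.le⟩
      obtain ⟨s, hs, hs0⟩ := intermediate_value_uIcc hcont h0
      rw [uIcc_of_le (by linarith)] at hs
      exact ⟨s, fun _ => ⟨hs, hs0⟩⟩
    · exact ⟨0, fun h => absurd h hk⟩
  choose s hs using key
  refine ⟨s, strictMono_lt_of_succ fun k hk => ?_, fun k hk => ⟨⟨?_, ?_⟩, (hs k hk).2⟩⟩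
  · have e1 := (hs k (by omega)).1.2
    have e2 := (hs (k + 1) hk).1.1
    have e3 := (hε k (Finset.mem_range.2 (by omega))).2.2.2 hk
    linarith
  · linarith [(hs k hk).1.1, (hε k (Finset.mem_range.2 hk)).2.1]
  · linarith [(hs k hk).1.2, (hε k (Finset.mem_range.2 hk)).2.2.1]

/-- Zeros in `t` of `F lam` enter `(0, τ]` through `τ` only, as `lam` grows from `0`. -/
theorem le_encard_of_hasDistinctZeros {F G : ℝ → ℝ → ℝ} (hF : Continuous (Function.uncurry F))
    (hG : Continuous (Function.uncurry G)) {τ : ℝ}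
    (hz : ∀ x, ∃ δ > 0, ∀ᶠ y in 𝓝 x, ∀ t ∈ Ioo 0 δ, F y t ≠ 0)
    (hne : ∀ x, ∀ t, 0 < t → F x t = 0 → G x t ≠ 0)
    (hd : ∀ x, 0 < x → ∀ t, 0 < t → ∃ c ≠ 0, HasDerivAt (F x) (c * G x t) t)
    (h0 : ∀ t, 0 < t → F 0 t ≠ 0) {x : ℝ} (hx : 0 ≤ x) {N : ℕ}
    (h : HasDistinctZeros (F x) τ N) :
    (N : ℕ∞) ≤ ({y | 0 < y ∧ F y τ = 0} ∩ Iic x).encard := by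
  set S : Set ℝ := {y | 0 < y ∧ F y τ = 0} with hS
  by_contra hbad
  -- Continuous induction on the parameter: `B` is the set of counterexamples and `b` its infimum.
  -- Persistence of zeros to the left of `b` excludes `b` itself, and convergence of zeros from the
  -- right then excludes counterexamples arbitrarily close above it.
  set B : Set ℝ := {y | 0 ≤ y ∧ ∃ N : ℕ, HasDistinctZeros (F y) τ N ∧
    ¬ (N : ℕ∞) ≤ (S ∩ Iic y).encard} with hB
  have hBne : B.Nonempty := ⟨x, hx, N, h, hbad⟩
  have hBbdd : BddBelow B := ⟨0, fun y hy => hy.1⟩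
  set b := sInf B with hb
  have hb0 : 0 ≤ b := le_csInf hBne fun y hy => hy.1
  have hlt : ∀ y, 0 ≤ y → y < b → ∀ M : ℕ, HasDistinctZeros (F y) τ M →
      (M : ℕ∞) ≤ (S ∩ Iic y).encard := by
    intro y hy hyb M hM
    by_contra hcon
    exact absurd (csInf_le hBbdd (show y ∈ B from ⟨hy, M, hM, hcon⟩)) (not_le.2 hyb)
  -- there is no counterexample at `b`
  have hgood : ∀ M : ℕ, HasDistinctZeros (F b) τ M → (M : ℕ∞) ≤ (S ∩ Iic b).encard := by
    rcases hb0.eq_or_lt with hbz | hbpos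
    · intro M hM
      rcases Nat.eq_zero_or_pos M with rfl | hMpos
      · simp
      · obtain ⟨t, -, ht⟩ := hM
        rw [← hbz] at ht
        exact absurd (ht 0 hMpos).2 (h0 _ (ht 0 hMpos).1.1)
    · have hsimple : ∀ s ∈ Ioo 0 τ, F b s = 0 → ∃ c ≠ 0, HasDerivAt (F b) c s := by
        intro s hs hs0
        obtain ⟨c, hc, hder⟩ := hd b hbpos s hs.1
        exact ⟨_, mul_ne_zero hc (hne b s hs.1 hs0), hder⟩
      have hleft : ∀ M : ℕ, ∀ t : ℕ → ℝ, (∀ k l, k < l → l < M → t k < t l) →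
          (∀ k < M, t k ∈ Ioo 0 τ ∧ F b (t k) = 0) →
          ∃ y < b, (M : ℕ∞) ≤ (S ∩ Iic y).encard := by
        intro M t hm ht
        have hev := eventually_hasDistinctZeros hF hm ht hsimple
        obtain ⟨y, ⟨hy1, hy2⟩, hyb⟩ := (((hev.filter_mono nhdsWithin_le_nhds).and
          ((eventually_gt_nhds hbpos).filter_mono nhdsWithin_le_nhds)).and
          (self_mem_nhdsWithin : ∀ᶠ y in 𝓝[<] b, y < b)).exists
        exact ⟨y, hyb, hlt y hy2.le hyb M hy1⟩
      intro M hM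
      obtain ⟨t, hm, ht⟩ := hM
      rcases Nat.eq_zero_or_pos M with rfl | hMpos
      · simp
      · obtain ⟨K, rfl⟩ : ∃ K, M = K + 1 := ⟨M - 1, by omega⟩
        have hKτ : ∀ k < K, t k < τ := fun k hk =>
          (hm k K hk (by omega)).trans_le (ht K (by omega)).1.2
        -- Only the last zero can lie at `τ`. In that case `b` is itself a new element of `S`, while
        -- the remaining `K` zeros are interior and already accounted for at some `y < b`.
        rcases (ht K (by omega)).1.2.eq_or_lt with he | hlτ
        · obtain ⟨y, hyb, hy⟩ := hleft K t (fun k l hkl hl => hm k l hkl (by omega))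
            (fun k hk => ⟨⟨(ht k (by omega)).1.1, hKτ k hk⟩, (ht k (by omega)).2⟩)
          have hbS : b ∈ S := ⟨hbpos, he ▸ (ht K (by omega)).2⟩
          have hnot : b ∉ S ∩ Iic y := fun h => absurd h.2 (not_le.2 hyb)
          calc ((K + 1 : ℕ) : ℕ∞) = (K : ℕ∞) + 1 := by push_cast; rfl
            _ ≤ (S ∩ Iic y).encard + 1 := by gcongr
            _ = (insert b (S ∩ Iic y)).encard := (encard_insert_of_notMem hnot).symm
            _ ≤ _ := encard_le_encard (insert_subset (show b ∈ S ∩ Iic b from ⟨hbS, le_refl b⟩)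
                (inter_subset_inter_right _ (Iic_subset_Iic.2 hyb.le)))
        · obtain ⟨y, hyb, hy⟩ := hleft (K + 1) t hm (fun k hk => ⟨⟨(ht k hk).1.1, by
            rcases (Nat.lt_succ_iff.1 hk).eq_or_lt with rfl | hk'
            · exact hlτ
            · exact hKτ k hk'⟩, (ht k hk).2⟩)
          exact hy.trans (encard_le_encard (inter_subset_inter_right _ (Iic_subset_Iic.2 hyb.le)))
  -- hence the counterexamples accumulate at `b` from the right
  have htop : (S ∩ Iic b).encard ≠ ⊤ := by
    intro htop
    obtain ⟨y, ⟨hy0, M, hyM, hM⟩⟩ := hBne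
    refine hM ?_
    have : (S ∩ Iic y).encard = ⊤ := top_le_iff.1 (htop ▸ encard_le_encard
      (inter_subset_inter_right _ (Iic_subset_Iic.2 (csInf_le hBbdd ⟨hy0, M, hyM, hM⟩))))
    rw [this]
    exact le_top
  obtain ⟨C, hC⟩ := ENat.ne_top_iff_exists.1 htop
  have hfreq : ∃ᶠ y in 𝓝 b, ∃ t : ℕ → ℝ, (∀ k < C + 1, t k ∈ Ioc 0 τ ∧ F y (t k) = 0) ∧
      ∀ k, k + 1 < C + 1 → t k ≤ t (k + 1) ∧ ∃ s ∈ Icc (t k) (t (k + 1)), G y s = 0 := by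
    rw [frequently_iff]
    intro U hU
    obtain ⟨ε, hε, hball⟩ := Metric.mem_nhds_iff.1 hU
    obtain ⟨y, hyB, hyb⟩ := exists_lt_of_csInf_lt hBne (show sInf B < b + ε by
      rw [← hb]; linarith)
    have hby : b ≤ y := csInf_le hBbdd hyB
    refine ⟨y, hball (by rw [Metric.mem_ball, Real.dist_eq, abs_of_nonneg] <;> linarith), ?_⟩
    obtain ⟨hy0, M, hM, hMc⟩ := hyB
    have hCM : C + 1 ≤ M := by
      have h1 : (S ∩ Iic b).encard < M := lt_of_le_of_lt (encard_le_encard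
        (inter_subset_inter_right _ (Iic_subset_Iic.2 hby))) (not_le.1 hMc)
      rw [← hC] at h1
      exact_mod_cast h1
    obtain ⟨t, hm, ht⟩ := hM.take hCM
    refine ⟨t, ht, fun k hk => ⟨(hm k (k + 1) (by omega) hk).le, ?_⟩⟩
    have hypos : 0 < y := by
      refine hy0.lt_of_ne fun he => ?_
      exact h0 _ (ht 0 (by omega)).1.1 (he ▸ (ht 0 (by omega)).2)
    have hpos := (ht k (by omega)).1.1
    choose! c hc hder using hd y hypos
    obtain ⟨s, hs, hs0⟩ := exists_hasDerivAt_eq_zero (hm k (k + 1) (by omega) hk)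
      (f' := fun s => c s * G y s)
      (hF.comp (continuous_const.prodMk continuous_id)).continuousOn
      ((ht k (by omega)).2.trans (ht (k + 1) hk).2.symm)
      (fun s hs => hder s (hpos.trans hs.1))
    exact ⟨s, Ioo_subset_Icc_self hs, (mul_eq_zero.1 hs0).resolve_left (hc s (hpos.trans hs.1))⟩
  -- The `C + 1` zeros of the nearby counterexamples converge to `C + 1` distinct zeros at `b`,
  -- where only `C` are allowed.
  have := hgood _ (hasDistinctZeros_of_frequently hF hG (hz b) (fun t ht => hne b t ht.1) hfreq)
  rw [← hC] at this
  have : C + 1 ≤ C := by exact_mod_cast this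
  omega

end SturmChain

/-! ### Sturm–Liouville families with a monotone weight. -/

/-- The solutions `ψ lam` of `(w ψ')' + lam² w ψ = 0`, `ψ(0) = 1`, in integrated form, for a
monotone weight `w`. -/
structure SLFamily (w : ℝ → ℝ) (ψ : ℝ → ℝ → ℝ) : Prop where
  w_cont : Continuous w
  w_pos : ∀ t, 0 < t → 0 < w t
  w_mono : MonotoneOn w (Ici 0)
  w_smooth : ContDiffOn ℝ ∞ w (Ioi 0)
  zero : ∀ t, ψ 0 t = 1
  even : ∀ lam t, ψ lam (-t) = ψ lam t
  at_zero : ∀ lam, ψ lam 0 = 1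
  deriv : ∀ lam t, 0 ≤ t →
    HasDerivAt (ψ lam) (-(lam ^ 2 * ((∫ s in (0 : ℝ)..t, w s * ψ lam s) / w t))) t

namespace SLFamily

/-- The integrated flux `∫₀ᵗ w ψ = -lam⁻² w ψ'`. -/
noncomputable def flux (w : ℝ → ℝ) (ψ : ℝ → ℝ → ℝ) (lam t : ℝ) : ℝ :=
  ∫ s in (0 : ℝ)..t, w s * ψ lam s

variable {w : ℝ → ℝ} {ψ : ℝ → ℝ → ℝ}

theorem flux_zero (lam : ℝ) : flux w ψ lam 0 = 0 := by simp [flux]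

theorem abs_eq (h : SLFamily w ψ) (lam t : ℝ) : ψ lam |t| = ψ lam t := by
  rcases abs_choice t with e | e <;> rw [e]
  exact h.even lam t

theorem continuous (h : SLFamily w ψ) (lam : ℝ) : Continuous (ψ lam) := by
  have hc : ContinuousOn (ψ lam) (Ici 0) := fun t ht =>
    (h.deriv lam t ht).continuousAt.continuousWithinAt
  have : Continuous fun t => ψ lam |t| :=
    hc.comp_continuous continuous_abs fun t => abs_nonneg t
  exact this.congr fun t => h.abs_eq lam t

theorem w_nonneg (h : SLFamily w ψ) {t : ℝ} (ht : 0 ≤ t) : 0 ≤ w t := by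
  have hlim : Tendsto w (𝓝[>] t) (𝓝 (w t)) := h.w_cont.continuousAt.mono_left nhdsWithin_le_nhds
  refine ge_of_tendsto hlim ?_
  filter_upwards [self_mem_nhdsWithin] with s hs
  exact (h.w_pos s (ht.trans_lt hs)).le

theorem hasDerivAt_flux (h : SLFamily w ψ) (lam t : ℝ) :
    HasDerivAt (flux w ψ lam) (w t * ψ lam t) t :=
  ((h.w_cont.mul (h.continuous lam)).integral_hasStrictDerivAt 0 t).hasDerivAt

theorem hasDerivAt (h : SLFamily w ψ) (lam : ℝ) {t : ℝ} (ht : 0 ≤ t) :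
    HasDerivAt (ψ lam) (-(lam ^ 2 * (flux w ψ lam t / w t))) t := h.deriv lam t ht

/-- Gronwall's argument with a Gaussian weight. -/
theorem abs_sub_le (h : SLFamily w ψ) (lam mu : ℝ) {T C : ℝ} (hT : 0 ≤ T)
    (hC : ∀ s ∈ Icc 0 T, |ψ mu s| ≤ C) : ∀ t ∈ Icc 0 T,
    |ψ lam t - ψ mu t| ≤ |lam ^ 2 - mu ^ 2| * C * T ^ 2 * Real.exp (lam ^ 2 * T ^ 2) := by
  set η := |lam ^ 2 - mu ^ 2| * C with hη
  have hC0 : 0 ≤ C := (abs_nonneg _).trans (hC 0 ⟨le_rfl, hT⟩)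
  have hη0 : 0 ≤ η := by positivity
  set d : ℝ → ℝ := fun t => ψ lam t - ψ mu t with hd
  have hdc : Continuous d := (h.continuous lam).sub (h.continuous mu)
  have hcont : Continuous fun t => |d t| * Real.exp (-(lam ^ 2 * t ^ 2)) := by fun_prop
  obtain ⟨u, hu, hmax⟩ := (isCompact_Icc (a := (0 : ℝ)) (b := T)).exists_isMaxOn ⟨0, le_rfl, hT⟩
    hcont.continuousOn
  -- `M` is the Gaussian-weighted sup norm of the difference, attained at `u`. Since `w s ≤ w x` for
  -- `s ≤ x`, the quotient `(∫₀ˣ w f) / w x` is at most `x` times a bound for `f`, even if `w 0 =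
  -- 0`. Inserting `M` bounds `d'`, and integrating bounds `d`.
  set M := |d u| * Real.exp (-(lam ^ 2 * u ^ 2)) with hM
  have hM0 : 0 ≤ M := by positivity
  have hdM : ∀ s ∈ Icc 0 T, |d s| ≤ M * Real.exp (lam ^ 2 * s ^ 2) := by
    intro s hs
    have : |d s| * Real.exp (-(lam ^ 2 * s ^ 2)) ≤ M := hmax hs
    rw [Real.exp_neg, ← div_eq_mul_inv, div_le_iff₀ (Real.exp_pos _)] at this
    exact this
  have hB : ∀ t : ℝ, HasDerivAt
      (fun t => M * (Real.exp (lam ^ 2 * t ^ 2) - 1) / 2 + η * t ^ 2 / 2)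
      (t * (lam ^ 2 * M * Real.exp (lam ^ 2 * t ^ 2) + η)) t := by
    intro t
    have h1 : HasDerivAt (fun t : ℝ => t ^ 2) (2 * t) t := by
      simpa using hasDerivAt_pow 2 t
    have h2 := ((h1.const_mul (lam ^ 2)).exp.sub_const 1).const_mul M |>.div_const 2
    refine (h2.add ((h1.const_mul η).div_const 2)).congr_deriv ?_
    ring
  have hbound : ∀ t ∈ Icc 0 T,
      |d t| ≤ M * (Real.exp (lam ^ 2 * t ^ 2) - 1) / 2 + η * t ^ 2 / 2 := by
    intro t ht
    refine image_norm_le_of_norm_deriv_right_le_deriv_boundary (f := d)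
      (f' := fun t => -(lam ^ 2 * (flux w ψ lam t / w t)) - -(mu ^ 2 * (flux w ψ mu t / w t)))
      hdc.continuousOn
      (fun x hx => ((h.hasDerivAt lam hx.1).sub (h.hasDerivAt mu hx.1)).hasDerivWithinAt)
      (by simp [hd, h.at_zero]) hB (fun x hx => ?_) ht
    rcases hx.1.eq_or_lt with rfl | hx0
    · simp [flux_zero]
    have hwx := h.w_pos x hx0
    have hint : ‖∫ s in (0 : ℝ)..x, w s * (lam ^ 2 * ψ lam s - mu ^ 2 * ψ mu s)‖ ≤
        w x * (lam ^ 2 * M * Real.exp (lam ^ 2 * x ^ 2) + η) * |x - 0| := by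
      refine intervalIntegral.norm_integral_le_of_norm_le_const fun s hs => ?_
      rw [uIoc_of_le hx0.le] at hs
      have hsT : s ∈ Icc 0 T := ⟨hs.1.le, hs.2.trans hx.2.le⟩
      rw [Real.norm_eq_abs, abs_mul, abs_of_pos (h.w_pos s hs.1)]
      refine mul_le_mul (h.w_mono hs.1.le hx0.le hs.2) ?_ (abs_nonneg _) hwx.le
      have e : lam ^ 2 * ψ lam s - mu ^ 2 * ψ mu s =
          lam ^ 2 * d s + (lam ^ 2 - mu ^ 2) * ψ mu s := by simp only [hd]; ring
      rw [e]
      refine (abs_add_le _ _).trans (add_le_add ?_ ?_)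
      · rw [abs_mul, abs_of_nonneg (sq_nonneg lam), mul_assoc]
        refine mul_le_mul_of_nonneg_left ((hdM s hsT).trans ?_) (sq_nonneg _)
        have : s ^ 2 ≤ x ^ 2 := pow_le_pow_left₀ hs.1.le hs.2 2
        gcongr
      · rw [abs_mul]
        exact mul_le_mul_of_nonneg_left (hC s hsT) (abs_nonneg _)
    have hsplit : ∫ s in (0 : ℝ)..x, w s * (lam ^ 2 * ψ lam s - mu ^ 2 * ψ mu s) =
        lam ^ 2 * flux w ψ lam x - mu ^ 2 * flux w ψ mu x := by
      unfold flux
      rw [← intervalIntegral.integral_const_mul, ← intervalIntegral.integral_const_mul,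
        ← intervalIntegral.integral_sub]
      · exact intervalIntegral.integral_congr fun s _ => by ring
      · exact (((h.w_cont.mul (h.continuous lam)).const_mul _)).intervalIntegrable _ _
      · exact (((h.w_cont.mul (h.continuous mu)).const_mul _)).intervalIntegrable _ _
    rw [hsplit, sub_zero, abs_of_pos hx0, Real.norm_eq_abs] at hint
    have e : -(lam ^ 2 * (flux w ψ lam x / w x)) - -(mu ^ 2 * (flux w ψ mu x / w x)) =
        -((lam ^ 2 * flux w ψ lam x - mu ^ 2 * flux w ψ mu x) / w x) := by ring
    rw [e, norm_neg, Real.norm_eq_abs, abs_div, abs_of_pos hwx, div_le_iff₀ hwx]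
    refine hint.trans (le_of_eq ?_)
    ring
  -- At `u` the bound contains `M` again, but only with half of the exponential, so it can be
  -- absorbed on the left.
  have hMle : M ≤ η * T ^ 2 := by
    have h1 := hbound u hu
    have h2 : |d u| = M * Real.exp (lam ^ 2 * u ^ 2) := by
      rw [hM, mul_assoc, ← Real.exp_add]; simp
    have h3 : 1 ≤ Real.exp (lam ^ 2 * u ^ 2) := Real.one_le_exp (by positivity)
    have h4 : η * u ^ 2 ≤ η * T ^ 2 :=
      mul_le_mul_of_nonneg_left (pow_le_pow_left₀ hu.1 hu.2 2) hη0
    nlinarith [mul_nonneg hM0 (sub_nonneg.2 h3)]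
  intro t ht
  have h5 : t ^ 2 ≤ T ^ 2 := pow_le_pow_left₀ ht.1 ht.2 2
  calc |d t| ≤ M * Real.exp (lam ^ 2 * t ^ 2) := hdM t ht
    _ ≤ η * T ^ 2 * Real.exp (lam ^ 2 * T ^ 2) := by gcongr

theorem continuous_uncurry (h : SLFamily w ψ) : Continuous (Function.uncurry ψ) := by
  rw [continuous_iff_continuousAt]
  rintro ⟨mu, t₀⟩
  set T := |t₀| + 1 with hT
  have hT0 : 0 ≤ T := by positivity
  obtain ⟨C, hC⟩ := (isCompact_Icc (a := (0 : ℝ)) (b := T)).exists_bound_of_continuousOn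
    (h.continuous mu).continuousOn
  have hlim : Tendsto (fun p : ℝ × ℝ => |p.1 ^ 2 - mu ^ 2| * C * T ^ 2 *
      Real.exp (p.1 ^ 2 * T ^ 2)) (𝓝 (mu, t₀)) (𝓝 0) := by
    have : Continuous fun p : ℝ × ℝ => |p.1 ^ 2 - mu ^ 2| * C * T ^ 2 *
      Real.exp (p.1 ^ 2 * T ^ 2) := by fun_prop
    simpa using this.tendsto (mu, t₀)
  have hdiff : Tendsto (fun p : ℝ × ℝ => ψ p.1 p.2 - ψ mu p.2) (𝓝 (mu, t₀)) (𝓝 0) := by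
    refine squeeze_zero_norm' ?_ hlim
    have hev : ∀ᶠ p : ℝ × ℝ in 𝓝 (mu, t₀), |p.2| < T :=
      (continuous_abs.comp continuous_snd).continuousAt.eventually_lt continuousAt_const
        (by simp [hT])
    filter_upwards [hev] with p hp
    rw [Real.norm_eq_abs, ← h.abs_eq p.1, ← h.abs_eq mu]
    exact h.abs_sub_le p.1 mu hT0 hC _ ⟨abs_nonneg _, hp.le⟩
  have h2 : Tendsto (fun p : ℝ × ℝ => ψ mu p.2) (𝓝 (mu, t₀)) (𝓝 (ψ mu t₀)) :=
    ((h.continuous mu).comp continuous_snd).tendsto (mu, t₀)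
  have := hdiff.add h2
  simp only [sub_add_cancel, zero_add] at this
  exact this

theorem continuous_uncurry_flux (h : SLFamily w ψ) :
    Continuous (Function.uncurry (flux w ψ)) := by
  have hc : Continuous (Function.uncurry fun (p : ℝ × ℝ) s => w s * ψ p.1 s) :=
    (h.w_cont.comp continuous_snd).mul (h.continuous_uncurry.comp
      ((continuous_fst.comp continuous_fst).prodMk continuous_snd))
  exact intervalIntegral.continuous_parametric_intervalIntegral_of_continuous (a₀ := 0) hc
    continuous_snd

theorem exists_pos_near_zero (h : SLFamily w ψ) (x : ℝ) :
    ∃ δ > 0, ∀ᶠ y in 𝓝 x, ∀ t ∈ Ico 0 δ, 0 < ψ y t := by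
  have hev : ∀ᶠ p : ℝ × ℝ in 𝓝 (x, 0), 0 < ψ p.1 p.2 :=
    continuousAt_const.eventually_lt h.continuous_uncurry.continuousAt (by simp [h.at_zero])
  rw [nhds_prod_eq, eventually_prod_iff] at hev
  obtain ⟨pa, hpa, pb, hpb, hp⟩ := hev
  obtain ⟨δ, hδ, hball⟩ := Metric.eventually_nhds_iff.1 hpb
  refine ⟨δ, hδ, ?_⟩
  filter_upwards [hpa] with y hy t ht
  exact hp hy (hball (by rw [Real.dist_eq, sub_zero, abs_of_nonneg ht.1]; exact ht.2))

theorem flux_pos (h : SLFamily w ψ) {lam t : ℝ} (ht : 0 < t) (hψ : ∀ s ∈ Ioo 0 t, 0 < ψ lam s) :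
    0 < flux w ψ lam t :=
  intervalIntegral.intervalIntegral_pos_of_pos_on
    ((h.w_cont.mul (h.continuous lam)).intervalIntegrable _ _)
    (fun s hs => mul_pos (h.w_pos s hs.1) (hψ s hs)) ht

/-- Backward uniqueness away from the singular point: on `[ε, t]` the energy `ψ² + flux²` times `exp
(K s)` is nondecreasing, so vanishing at `t` forces vanishing at every `ε`, against `ψ(0) = 1`.
Hence zeros of `ψ` and of the flux are simple. -/
theorem not_both_zero (h : SLFamily w ψ) {lam t : ℝ} (ht : 0 < t) (h1 : ψ lam t = 0)
    (h2 : flux w ψ lam t = 0) : False := by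
  have key : ∀ ε ∈ Ioo 0 t, ψ lam ε = 0 := by
    intro ε hε
    -- By monotonicity of `w`, this dominates `w s + lam² / w s` on `[ε, t]`, the rate at which the
    -- energy can change.
    set K := lam ^ 2 / w ε + w t with hK
    have hwε := h.w_pos ε hε.1
    have hmono : MonotoneOn (fun s => (ψ lam s ^ 2 + flux w ψ lam s ^ 2) * Real.exp (K * s))
        (Icc ε t) := by
      have hder : ∀ s, 0 < s → HasDerivAt
          (fun s => (ψ lam s ^ 2 + flux w ψ lam s ^ 2) * Real.exp (K * s))
          ((2 * ψ lam s * flux w ψ lam s * (w s - lam ^ 2 / w s) +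
            K * (ψ lam s ^ 2 + flux w ψ lam s ^ 2)) * Real.exp (K * s)) s := by
        intro s hs
        have e1 := (h.hasDerivAt lam hs.le).pow 2
        have e2 := (h.hasDerivAt_flux lam s).pow 2
        have e3 := ((hasDerivAt_id s).const_mul K).exp
        refine ((e1.add e2).mul e3).congr_deriv ?_
        simp only [Pi.add_apply, Pi.pow_apply, id]
        push_cast
        ring
      refine monotoneOn_of_deriv_nonneg (convex_Icc _ _)
        (fun s hs => (hder s (hε.1.trans_le hs.1)).continuousAt.continuousWithinAt)
        (fun s hs => ?_) (fun s hs => ?_)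
      · rw [interior_Icc] at hs
        exact (hder s (hε.1.trans hs.1)).differentiableAt.differentiableWithinAt
      · rw [interior_Icc] at hs
        have hs0 := hε.1.trans hs.1
        rw [(hder s hs0).deriv]
        refine mul_nonneg ?_ (Real.exp_pos _).le
        have hws := h.w_pos s hs0
        have a1 : w ε ≤ w s := h.w_mono hε.1.le hs0.le hs.1.le
        have a2 : w s ≤ w t := h.w_mono hs0.le ht.le hs.2.le
        have a3 : lam ^ 2 / w s ≤ lam ^ 2 / w ε := by gcongr
        have a4 : 0 ≤ lam ^ 2 / w s := by positivity
        set x := ψ lam s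
        set y := flux w ψ lam s
        have b1 : (w s + lam ^ 2 / w s) * (x ^ 2 + y ^ 2) ≤ K * (x ^ 2 + y ^ 2) := by
          refine mul_le_mul_of_nonneg_right ?_ (by positivity)
          linarith
        nlinarith [mul_nonneg hws.le (sq_nonneg (x + y)), mul_nonneg a4 (sq_nonneg (x - y))]
    have := hmono ⟨le_rfl, hε.2.le⟩ ⟨hε.2.le, le_rfl⟩ hε.2.le
    simp only [h1, h2] at this
    have hle : ψ lam ε ^ 2 + flux w ψ lam ε ^ 2 ≤ 0 := by
      refine nonpos_of_mul_nonpos_left (this.trans (by simp)) (Real.exp_pos _)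
    nlinarith [sq_nonneg (ψ lam ε), sq_nonneg (flux w ψ lam ε)]
  have hlim : Tendsto (ψ lam) (𝓝[>] 0) (𝓝 (ψ lam 0)) :=
    (h.continuous lam).continuousAt.mono_left nhdsWithin_le_nhds
  rw [h.at_zero] at hlim
  refine one_ne_zero (tendsto_nhds_unique (hlim.congr' ?_) (tendsto_const_nhds (x := (0 : ℝ))))
  filter_upwards [Ioo_mem_nhdsGT ht] with s hs using key s hs

/-- Lagrange's identity: in the derivative of the right side the products of two fluxes cancel.
Boundary conditions at `τ` make the right side vanish, and at `0` the fluxes vanish anyway. -/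
theorem orthogonal (h : SLFamily w ψ) (x y : ℝ) {τ : ℝ} (hτ : 0 < τ) :
    (x ^ 2 - y ^ 2) * ∫ s in (0 : ℝ)..τ, w s * (ψ x s * ψ y s) =
      x ^ 2 * flux w ψ x τ * ψ y τ - y ^ 2 * flux w ψ y τ * ψ x τ := by
  have hfc : ∀ x, Continuous (flux w ψ x) := fun x =>
    h.continuous_uncurry_flux.comp (continuous_const.prodMk continuous_id)
  have := intervalIntegral.integral_eq_sub_of_hasDerivAt_of_le hτ.le
    (f := fun s => x ^ 2 * flux w ψ x s * ψ y s - y ^ 2 * flux w ψ y s * ψ x s)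
    (f' := fun s => (x ^ 2 - y ^ 2) * (w s * (ψ x s * ψ y s)))
    (((((hfc x).const_mul _).mul (h.continuous y)).sub
      (((hfc y).const_mul _).mul (h.continuous x))).continuousOn)
    (fun s hs => by
      refine ((((h.hasDerivAt_flux x s).const_mul (x ^ 2)).mul (h.hasDerivAt y hs.1.le)).sub
        (((h.hasDerivAt_flux y s).const_mul (y ^ 2)).mul (h.hasDerivAt x hs.1.le))).congr_deriv ?_
      ring)
    ((((h.w_cont.mul ((h.continuous x).mul (h.continuous y))).const_mul _)).intervalIntegrable _ _)
  rw [intervalIntegral.integral_const_mul] at this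
  rw [this]
  simp [flux_zero]

/-- Parameters with pairwise orthogonal solutions do not accumulate. -/
theorem finite_of_orthogonal (h : SLFamily w ψ) {τ : ℝ} (hτ : 0 < τ) {S : Set ℝ}
    (hS : ∀ x ∈ S, 0 < x)
    (ho : ∀ x ∈ S, ∀ y ∈ S, x ≠ y → ∫ s in (0 : ℝ)..τ, w s * (ψ x s * ψ y s) = 0) (b : ℝ) :
    (S ∩ Iic b).Finite := by
  have hfin : (S ∩ Icc 0 b).Finite := by
    refine (isCompact_Icc (a := (0 : ℝ)) (b := b)).induction_on (p := fun U => (S ∩ U).Finite)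
      (by simp) (fun s t hst ht => ht.subset (inter_subset_inter_right _ hst))
      (fun s t hs ht => by rw [inter_union_distrib_left]; exact hs.union ht) (fun x _ => ?_)
    have hc : Continuous fun p : ℝ × ℝ => ∫ s in (0 : ℝ)..τ, w s * (ψ p.1 s * ψ p.2 s) := by
      refine intervalIntegral.continuous_parametric_intervalIntegral_of_continuous (a₀ := 0)
        (f := fun (p : ℝ × ℝ) s => w s * (ψ p.1 s * ψ p.2 s)) ?_ continuous_const
      exact (h.w_cont.comp continuous_snd).mul ((h.continuous_uncurry.comp
        ((continuous_fst.comp continuous_fst).prodMk continuous_snd)).mul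
        (h.continuous_uncurry.comp ((continuous_snd.comp continuous_fst).prodMk continuous_snd)))
    -- The integral is positive on the diagonal, hence near it by continuity. So a small
    -- neighbourhood of `x` cannot contain two parameters with orthogonal solutions, and compactness
    -- of `[0, b]` finishes.
    have hpos : 0 < ∫ s in (0 : ℝ)..τ, w s * (ψ x s * ψ x s) := by
      refine intervalIntegral.integral_pos hτ
        (h.w_cont.mul ((h.continuous x).mul (h.continuous x))).continuousOn
        (fun s hs => mul_nonneg (h.w_nonneg hs.1.le) (mul_self_nonneg _)) ?_
      obtain ⟨δ, hδ, hev⟩ := h.exists_pos_near_zero x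
      have hx := hev.self_of_nhds
      have hm : 0 < min (δ / 2) τ := lt_min (by linarith) hτ
      refine ⟨min (δ / 2) τ, ⟨hm.le, min_le_right _ _⟩, mul_pos (h.w_pos _ hm) ?_⟩
      exact mul_self_pos.2 (hx _ ⟨hm.le, (min_le_left _ _).trans_lt (by linarith)⟩).ne'
    have hev : ∀ᶠ p : ℝ × ℝ in 𝓝 (x, x), 0 < ∫ s in (0 : ℝ)..τ, w s * (ψ p.1 s * ψ p.2 s) :=
      continuousAt_const.eventually_lt hc.continuousAt hpos
    rw [nhds_prod_eq] at hev
    obtain ⟨U, hU, hUp⟩ := mem_prod_same_iff.1 hev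
    refine ⟨U, mem_nhdsWithin_of_mem_nhds hU, Set.Subsingleton.finite ?_⟩
    rintro a ⟨haS, haU⟩ c ⟨hcS, hcU⟩
    by_contra hne
    exact (show 0 < ∫ s in (0 : ℝ)..τ, w s * (ψ a s * ψ c s) from
      hUp (mk_mem_prod haU hcU)).ne' (ho a haS c hcS hne)
  refine hfin.subset ?_
  rintro y ⟨hyS, hyb⟩
  exact ⟨hyS, (hS y hyS).le, hyb⟩

/-- Solutions with a large parameter vanish somewhere on a given interval. -/
theorem eventually_exists_zero (h : SLFamily w ψ) {a b : ℝ} (ha : 0 < a) (hab : a < b) :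
    ∀ᶠ lam in atTop, ∃ t ∈ Icc a b, ψ lam t = 0 := by
  have hwa := h.w_pos a ha
  have hwb := h.w_pos b (ha.trans hab)
  -- By monotonicity, `c` is a lower bound for both `w` and `1 / w` on `[a, b]`.
  set c := min (w a) (w b)⁻¹ with hc
  have hc0 : 0 < c := lt_min hwa (inv_pos.2 hwb)
  filter_upwards [eventually_gt_atTop 0, eventually_ge_atTop (Real.pi / (c * (b - a)))]
    with lam hlam hlarge
  by_contra! hne
  -- A Prüfer angle: without zeros of `ψ` it is defined on all of `[a, b]`, and it grows at rate
  -- `lam (w cos² + w⁻¹ sin²) ≥ lam c`. Its total change is less than `π`, which fails for large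
  -- `lam`.
  have hder : ∀ s ∈ Icc a b, HasDerivAt
      (fun s => Real.arctan (lam * flux w ψ lam s / ψ lam s))
      (1 / (1 + (lam * flux w ψ lam s / ψ lam s) ^ 2) *
        (lam * (w s + (lam * flux w ψ lam s / ψ lam s) ^ 2 / w s))) s := by
    intro s hs
    have hs0 : 0 < s := ha.trans_le hs.1
    have hψ := hne s hs
    have hws := (h.w_pos s hs0).ne'
    refine (((h.hasDerivAt_flux lam s).const_mul lam).div (h.hasDerivAt lam hs0.le)
      hψ).arctan.congr_deriv ?_
    simp only [Pi.div_apply]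
    congr 1
    field_simp
    ring
  obtain ⟨s, hs, hslope⟩ := exists_hasDerivAt_eq_slope _ _ hab
    (fun s hs => (hder s hs).continuousAt.continuousWithinAt)
    (fun s hs => hder s (Ioo_subset_Icc_self hs))
  have hs0 := ha.trans hs.1
  set q := lam * flux w ψ lam s / ψ lam s
  have hws := h.w_pos s hs0
  have c1 : c ≤ w s := (min_le_left _ _).trans (h.w_mono ha.le hs0.le hs.1.le)
  have c2 : c ≤ (w s)⁻¹ := (min_le_right _ _).trans
    (inv_anti₀ hws (h.w_mono hs0.le (ha.trans hab).le hs.2.le))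
  have hge : lam * c ≤ 1 / (1 + q ^ 2) * (lam * (w s + q ^ 2 / w s)) := by
    rw [one_div_mul_eq_div, le_div_iff₀ (by positivity), mul_assoc]
    refine mul_le_mul_of_nonneg_left ?_ hlam.le
    rw [div_eq_mul_inv]
    nlinarith [mul_le_mul_of_nonneg_left c2 (sq_nonneg q)]
  rw [hslope, le_div_iff₀ (by linarith)] at hge
  rw [div_le_iff₀ (mul_pos hc0 (by linarith))] at hlarge
  have p1 := Real.arctan_lt_pi_div_two (lam * flux w ψ lam b / ψ lam b)
  have p2 := Real.neg_pi_div_two_lt_arctan (lam * flux w ψ lam a / ψ lam a)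
  nlinarith

theorem exists_hasDistinctZeros (h : SLFamily w ψ) {τ : ℝ} (hτ : 0 < τ) (N : ℕ) :
    ∃ lam > 0, SturmChain.HasDistinctZeros (ψ lam) τ N := by
  have hτN : 0 < τ / (2 * N + 2) := by positivity
  -- The cell size is chosen so that every second cell of `(0, τ)` can hold one zero. The gaps
  -- between these cells keep the zeros distinct.
  set η := τ / (2 * N + 2) with hη
  have hev : ∀ᶠ lam in atTop, ∀ k ∈ Finset.range N,
      ∃ t ∈ Icc (η * (2 * k + 1)) (η * (2 * k + 2)), ψ lam t = 0 := by
    rw [eventually_all_finset]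
    exact fun k _ => h.eventually_exists_zero (by positivity) (by nlinarith)
  obtain ⟨lam, hlam, hpos⟩ := (hev.and (eventually_gt_atTop 0)).exists
  have key : ∀ k, ∃ t, k < N → t ∈ Icc (η * (2 * k + 1)) (η * (2 * k + 2)) ∧ ψ lam t = 0 := by
    intro k
    by_cases hk : k < N
    · obtain ⟨t, ht⟩ := hlam k (Finset.mem_range.2 hk)
      exact ⟨t, fun _ => ht⟩
    · exact ⟨0, fun h => absurd h hk⟩
  choose t ht using key
  refine ⟨lam, hpos, t, SturmChain.strictMono_lt_of_succ fun k hk => ?_, fun k hk =>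
    ⟨⟨?_, ?_⟩, (ht k hk).2⟩⟩
  · have e1 := (ht k (by omega)).1.2
    have e2 := (ht (k + 1) hk).1.1
    push_cast at e2
    nlinarith
  · exact lt_of_lt_of_le (by positivity) (ht k hk).1.1
  · refine (ht k hk).1.2.trans ?_
    have : (2 * (k : ℝ) + 2) ≤ 2 * N + 2 := by
      have : (k : ℝ) ≤ N := by exact_mod_cast hk.le
      linarith
    calc η * (2 * k + 2) ≤ η * (2 * N + 2) := by gcongr
      _ = τ := by rw [hη]; field_simp

end SLFamily

/-! ### Increasing enumeration of an infinite, locally finite set bounded below. -/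

section Enumeration

variable {S : Set ℝ}

theorem isLeast_csInf_of_finite_inter_Iic (hfin : ∀ b, (S ∩ Iic b).Finite) {U : Set ℝ}
    (hU : U ⊆ S) (hne : U.Nonempty) : IsLeast U (sInf U) := by
  obtain ⟨b, hb⟩ := hne
  have hUb : (U ∩ Iic b).Finite := (hfin b).subset (inter_subset_inter_left _ hU)
  obtain ⟨a, ha, hmin⟩ := hUb.exists_minimal ⟨b, hb, le_refl b⟩
  have hleast : IsLeast U a := by
    refine ⟨ha.1, fun y hy => ?_⟩
    by_contra! hlt
    exact absurd (hmin ⟨hy, hlt.le.trans ha.2⟩ hlt.le) (not_le.2 hlt)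
  rwa [hleast.csInf_eq]

theorem nthSmallest_succ_isLeast (hfin : ∀ b, (S ∩ Iic b).Finite) (hinf : S.Infinite) (k : ℕ) :
    IsLeast {x | x ∈ S ∧ nthSmallest S k < x} (nthSmallest S (k + 1)) := by
  refine isLeast_csInf_of_finite_inter_Iic hfin (fun x hx => hx.1) ?_
  obtain ⟨x, hx, hx'⟩ := hinf.exists_notMem_finite (hfin (nthSmallest S k))
  exact ⟨x, hx, not_le.1 fun h => hx' ⟨hx, h⟩⟩

theorem nthSmallest_mem (hfin : ∀ b, (S ∩ Iic b).Finite) (hinf : S.Infinite) (k : ℕ) :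
    nthSmallest S k ∈ S := by
  cases k with
  | zero => exact (isLeast_csInf_of_finite_inter_Iic hfin Subset.rfl hinf.nonempty).1
  | succ k => exact (nthSmallest_succ_isLeast hfin hinf k).1.1

theorem nthSmallest_strictMono (hfin : ∀ b, (S ∩ Iic b).Finite) (hinf : S.Infinite) :
    StrictMono (nthSmallest S) :=
  strictMono_nat_of_lt_succ fun k => (nthSmallest_succ_isLeast hfin hinf k).1.2

theorem encard_inter_Iic_nthSmallest_le (hfin : ∀ b, (S ∩ Iic b).Finite) (hinf : S.Infinite)
    (k : ℕ) : (S ∩ Iic (nthSmallest S k)).encard ≤ ((k + 1 : ℕ) : ℕ∞) := by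
  induction k with
  | zero =>
    have hl := isLeast_csInf_of_finite_inter_Iic hfin Subset.rfl hinf.nonempty
    refine (encard_le_encard (t := {nthSmallest S 0}) ?_).trans (by simp)
    rintro x ⟨hx, hxl⟩
    exact le_antisymm hxl (hl.2 hx)
  | succ k ih =>
    have hl := nthSmallest_succ_isLeast hfin hinf k
    refine (encard_le_encard (t := insert (nthSmallest S (k + 1))
      (S ∩ Iic (nthSmallest S k))) ?_).trans ((encard_insert_le _ _).trans ?_)
    · rintro x ⟨hx, hxl⟩
      rcases le_or_gt x (nthSmallest S k) with h | h
      · exact Or.inr ⟨hx, h⟩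
      · exact Or.inl (le_antisymm hxl (hl.2 ⟨hx, h⟩))
    · rw [Nat.cast_succ (k + 1)]
      gcongr

end Enumeration

/-! ### Counting zeros in `t` by zeros in the parameter. -/

namespace SLFamily

variable {w : ℝ → ℝ} {ψ : ℝ → ℝ → ℝ} {τ : ℝ}

/-- The solution and its flux are, up to nonvanishing factors, derivatives of one another for
positive parameters, and never vanish together on `(0, ∞)`. The oscillation count therefore applies
to either of them, here and in `le_encard_of_flux_zeros`. -/
theorem le_encard_of_psi_zeros (h : SLFamily w ψ) {x : ℝ} (hx : 0 ≤ x) {N : ℕ}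
    (hN : SturmChain.HasDistinctZeros (ψ x) τ N) :
    (N : ℕ∞) ≤ ({y | 0 < y ∧ ψ y τ = 0} ∩ Iic x).encard := by
  refine SturmChain.le_encard_of_hasDistinctZeros h.continuous_uncurry h.continuous_uncurry_flux
    (fun x => ?_) (fun x t ht h1 h2 => h.not_both_zero ht h1 h2) (fun x hx t ht => ?_)
    (fun t _ => by simp [h.zero]) hx hN
  · obtain ⟨δ, hδ, hev⟩ := h.exists_pos_near_zero x
    exact ⟨δ, hδ, hev.mono fun y hy t ht => (hy t ⟨ht.1.le, ht.2⟩).ne'⟩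
  · have hw := h.w_pos t ht
    refine ⟨-(x ^ 2 / w t), neg_ne_zero.2 (by positivity), (h.hasDerivAt x ht.le).congr_deriv ?_⟩
    ring

theorem le_encard_of_flux_zeros (h : SLFamily w ψ) {x : ℝ} (hx : 0 ≤ x) {N : ℕ}
    (hN : SturmChain.HasDistinctZeros (flux w ψ x) τ N) :
    (N : ℕ∞) ≤ ({y | 0 < y ∧ flux w ψ y τ = 0} ∩ Iic x).encard := by
  refine SturmChain.le_encard_of_hasDistinctZeros h.continuous_uncurry_flux h.continuous_uncurry
    (fun x => ?_) (fun x t ht h1 h2 => h.not_both_zero ht h2 h1)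
    (fun x _ t ht => ⟨w t, (h.w_pos t ht).ne', h.hasDerivAt_flux x t⟩)
    (fun t ht => (h.flux_pos ht fun s _ => by simp [h.zero]).ne') hx hN
  obtain ⟨δ, hδ, hev⟩ := h.exists_pos_near_zero x
  exact ⟨δ, hδ, hev.mono fun y hy t ht =>
    (h.flux_pos ht.1 fun s hs => hy s ⟨hs.1.le, hs.2.trans ht.2⟩).ne'⟩

theorem exists_flux_zero_between (h : SLFamily w ψ) {x : ℝ} (hx : 0 < x) (a b : ℝ) (ha : 0 < a)
    (hab : a < b) (h1 : ψ x a = 0) (h2 : ψ x b = 0) : ∃ s ∈ Ioo a b, flux w ψ x s = 0 := by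
  obtain ⟨s, hs, hs0⟩ := exists_hasDerivAt_eq_zero hab (h.continuous x).continuousOn
    (h1.trans h2.symm) (fun s hs => h.hasDerivAt x (ha.trans hs.1).le)
  refine ⟨s, hs, ?_⟩
  have := (h.w_pos s (ha.trans hs.1)).ne'
  have hx2 : x ^ 2 ≠ 0 := by positivity
  simpa [hx2, this, hx.ne'] using hs0

theorem infinite_psi_zeros (h : SLFamily w ψ) (hτ : 0 < τ) :
    {y | 0 < y ∧ ψ y τ = 0}.Infinite := by
  refine encard_eq_top_iff.1 (ENat.eq_top_iff_forall_ge.2 fun N => ?_)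
  obtain ⟨x, hx, hN⟩ := h.exists_hasDistinctZeros hτ N
  exact (h.le_encard_of_psi_zeros hx.le hN).trans (encard_le_encard inter_subset_left)

theorem infinite_flux_zeros (h : SLFamily w ψ) (hτ : 0 < τ) :
    {y | 0 < y ∧ flux w ψ y τ = 0}.Infinite := by
  refine encard_eq_top_iff.1 (ENat.eq_top_iff_forall_ge.2 fun N => ?_)
  obtain ⟨x, hx, hN⟩ := h.exists_hasDistinctZeros hτ (N + 1)
  obtain ⟨t, h1, h2⟩ := hN.rolle (h.exists_flux_zero_between hx)
  exact (h.le_encard_of_flux_zeros hx.le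
    ⟨t, h1, fun k hk => ⟨Ioo_subset_Ioc_self (h2 k hk).1, (h2 k hk).2⟩⟩).trans
    (encard_le_encard inter_subset_left)

theorem finite_psi_zeros (h : SLFamily w ψ) (hτ : 0 < τ) (b : ℝ) :
    ({y | 0 < y ∧ ψ y τ = 0} ∩ Iic b).Finite := by
  refine h.finite_of_orthogonal hτ (fun x hx => hx.1) (fun x hx y hy hne => ?_) b
  have := h.orthogonal x y hτ
  rw [hx.2, hy.2, mul_zero, mul_zero, sub_zero] at this
  refine (mul_eq_zero.1 this).resolve_left fun e => hne ?_
  exact (pow_left_inj₀ hx.1.le hy.1.le two_ne_zero).1 (sub_eq_zero.1 e)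

theorem finite_flux_zeros (h : SLFamily w ψ) (hτ : 0 < τ) (b : ℝ) :
    ({y | 0 < y ∧ flux w ψ y τ = 0} ∩ Iic b).Finite := by
  refine h.finite_of_orthogonal hτ (fun x hx => hx.1) (fun x hx y hy hne => ?_) b
  have := h.orthogonal x y hτ
  rw [hx.2, hy.2, mul_zero, mul_zero, zero_mul, zero_mul, sub_zero] at this
  refine (mul_eq_zero.1 this).resolve_left fun e => hne ?_
  exact (pow_left_inj₀ hx.1.le hy.1.le two_ne_zero).1 (sub_eq_zero.1 e)

end SLFamily

/-- Vanishing top coefficients can be dropped, which only sharpens the bound. The limit argument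
needs a nonzero dominant coefficient. -/
theorem isChebyshevSystem_of_top_coeff {f : ℕ → ℝ → ℝ} {I : Set ℝ}
    (h : ∀ (q : ℕ) (A : ℕ → ℝ), A q ≠ 0 →
      zeroCount I (fun t => ∑ k ∈ Finset.range (q + 1), A k * f k t) < ((q + 1 : ℕ) : ℕ∞)) :
    IsChebyshevSystem f I := by
  intro n
  induction n with
  | zero => rintro A ⟨k, hk, -⟩; omega
  | succ n ih =>
    rintro A ⟨k, hk, hAk⟩
    by_cases hn : A n = 0
    · have hkn : k ≠ n := fun e => hAk (e ▸ hn)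
      have := ih A ⟨k, by omega, hAk⟩
      simp only [Finset.sum_range_succ, hn, zero_mul, add_zero]
      exact this.trans (by exact_mod_cast Nat.lt_succ_self n)
    · exact h n A hn

/-! ### The Chebyshev property for Sturm–Liouville families. -/

namespace SLFamily

open SturmChain

variable {w : ℝ → ℝ} {ψ : ℝ → ℝ → ℝ} {τ : ℝ}

/-- `∑ A_k (-x_k²)^j f(x_k, t)`, over `k < n`. -/
noncomputable def combination (f : ℝ → ℝ → ℝ) (A x : ℕ → ℝ) (n j : ℕ) (t : ℝ) : ℝ :=
  ∑ k ∈ Finset.range n, A k * (-(x k) ^ 2) ^ j * f (x k) t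

/-- The quasi-derivatives of `C + ∑ A_k ψ(x_k, t)`. -/
noncomputable def chain (w : ℝ → ℝ) (ψ : ℝ → ℝ → ℝ) (C : ℝ) (A x : ℕ → ℝ) (n i : ℕ) (t : ℝ) : ℝ :=
  if Even i then (if i = 0 then C else 0) + combination ψ A x n (i / 2) t
  else combination (flux w ψ) A x n (i / 2 + 1) t

variable {C : ℝ} {A x : ℕ → ℝ} {n : ℕ}

theorem chain_zero (t : ℝ) :
    chain w ψ C A x n 0 t = C + ∑ k ∈ Finset.range n, A k * ψ (x k) t := by
  simp [chain, combination]

theorem chain_even (j : ℕ) (t : ℝ) : chain w ψ C A x n (2 * (j + 1)) t =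
    combination ψ A x n (j + 1) t := by
  simp [chain]

theorem chain_odd (j : ℕ) (t : ℝ) : chain w ψ C A x n (2 * j + 1) t =
    combination (flux w ψ) A x n (j + 1) t := by
  have : (2 * j + 1) / 2 = j := by omega
  simp [chain, this]

theorem chain_even' (j : ℕ) (t : ℝ) : chain w ψ C A x n (2 * j) t =
    (if j = 0 then C else 0) + combination ψ A x n j t := by
  simp [chain]

theorem chain_odd_eq_zero (j : ℕ) {t : ℝ} (ht : ∀ k, flux w ψ (x k) t = 0) :
    chain w ψ C A x n (2 * j + 1) t = 0 := by
  simp [chain_odd, combination, ht]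

/-- The two halves of `L` alternate: even steps multiply by `w⁻¹` and pass from solutions to fluxes,
odd steps multiply by `w` and pass back. One round trip multiplies the coefficient of index `k` by
`-(x k)²`, and the constant disappears at once. -/
theorem isChain (h : SLFamily w ψ) (C : ℝ) (A x : ℕ → ℝ) (n : ℕ) :
    IsChain (chain w ψ C A x n) (fun i t => if Even i then (w t)⁻¹ else w t) := by
  refine ⟨fun i => ?_, fun i s hs => ?_, fun i s hs => ?_, fun i => ?_⟩
  · obtain ⟨j, rfl | rfl⟩ := i.even_or_odd'
    · simp only [funext (chain_even' j)]
      exact continuous_const.add (continuous_finsetSum _ fun k _ =>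
        continuous_const.mul (h.continuous _))
    · simp only [funext (chain_odd j)]
      exact continuous_finsetSum _ fun k _ => continuous_const.mul
        (h.continuous_uncurry_flux.comp (continuous_const.prodMk continuous_id))
  · obtain ⟨j, rfl | rfl⟩ := i.even_or_odd'
    · rw [chain_odd, funext (chain_even' j)]
      simp only [even_two, Even.mul_right, if_true]
      refine ((HasDerivAt.fun_sum fun k _ =>
        (h.hasDerivAt (x k) hs.le).const_mul _).const_add _).congr_deriv ?_
      rw [combination, Finset.mul_sum]
      refine Finset.sum_congr rfl fun k _ => ?_
      rw [pow_succ]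
      ring
    · rw [show 2 * j + 1 + 1 = 2 * (j + 1) by ring, chain_even, funext (chain_odd j)]
      have : ¬ Even (2 * j + 1) := by simp
      simp only [this, if_false]
      refine (HasDerivAt.fun_sum fun k _ =>
        (h.hasDerivAt_flux (x k) s).const_mul _).congr_deriv ?_
      rw [combination, Finset.mul_sum]
      refine Finset.sum_congr rfl fun k _ => ?_
      ring
  · have := (h.w_pos s hs).ne'
    split_ifs
    · exact inv_ne_zero this
    · exact this
  · by_cases hi : Even i
    · simp only [hi, if_true]
      exact h.w_smooth.inv fun s hs => (h.w_pos s hs).ne'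
    · simp only [hi, if_false]
      exact h.w_smooth

/-- The quasi-derivatives of high order are dominated by the last term. -/
theorem hasDistinctZeros_of_chain (h : SLFamily w ψ) (hx : StrictMono x) (hx0 : ∀ k, 0 < x k)
    {q N : ℕ} (hq : A q ≠ 0) (hz : ∀ j, ∃ t, ZeroSeq (chain w ψ C A x (q + 1)) τ (2 * (j + 1)) N t ∧
      ∀ k < N, 0 < t k) : HasDistinctZeros (ψ (x q)) τ N := by
  set F : (ℕ → ℝ) → ℝ → ℝ := fun a t => ∑ k ∈ Finset.range (q + 1), a k * ψ (x k) t with hF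
  set G : (ℕ → ℝ) → ℝ → ℝ := fun a t =>
    ∑ k ∈ Finset.range (q + 1), a k * (x k) ^ 2 * flux w ψ (x k) t with hG
  -- Coefficients of `L^(j+1) p`, normalized by the last eigenvalue. They converge in the product
  -- topology to the last coefficient alone; the value `0` beyond `q` is needed there, as the powers
  -- would blow up for larger parameters.
  set a : ℕ → ℕ → ℝ := fun j k => if k ≤ q then A k * ((x k) ^ 2 / (x q) ^ 2) ^ (j + 1) else 0
    with ha
  set a₀ : ℕ → ℝ := fun k => if k = q then A q else 0 with ha₀
  have hFc : Continuous (Function.uncurry F) := by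
    refine continuous_finsetSum _ fun k _ => ?_
    exact ((continuous_apply k).comp continuous_fst).mul ((h.continuous (x k)).comp continuous_snd)
  have hGc : Continuous (Function.uncurry G) := by
    refine continuous_finsetSum _ fun k _ => ?_
    exact (((continuous_apply k).comp continuous_fst).mul continuous_const).mul
      ((h.continuous_uncurry_flux.comp (continuous_const.prodMk continuous_id)).comp continuous_snd)
  have hF₀ : ∀ t, F a₀ t = A q * ψ (x q) t := fun t => by
    simp [hF, ha₀, ite_mul]
  have hG₀ : ∀ t, G a₀ t = A q * (x q) ^ 2 * flux w ψ (x q) t := fun t => by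
    simp [hG, ha₀, ite_mul]
  have hlim : Tendsto a atTop (𝓝 a₀) := by
    refine tendsto_pi_nhds.2 fun k => ?_
    rcases lt_trichotomy k q with hk | rfl | hk
    · simp only [ha, ha₀, hk.le, hk.ne, if_true, if_false]
      have h1 : (x k) ^ 2 / (x q) ^ 2 < 1 := by
        rw [div_lt_one (by have := hx0 q; positivity)]
        exact pow_lt_pow_left₀ (hx hk) (hx0 k).le two_ne_zero
      have := ((tendsto_pow_atTop_nhds_zero_of_lt_one (by positivity) h1).comp
        (tendsto_add_atTop_nat 1)).const_mul (A k)
      simpa using this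
    · have : (x k) ^ 2 / (x k) ^ 2 = 1 := div_self (by have := hx0 k; positivity)
      simp [ha, ha₀, this]
    · simp [ha, ha₀, not_le.2 hk, hk.ne']
  have hxq : (-(x q) ^ 2) ≠ 0 := neg_ne_zero.2 (by have := hx0 q; positivity)
  have hratio : ∀ k, (x k) ^ 2 / (x q) ^ 2 = -(x k) ^ 2 / -(x q) ^ 2 := fun k =>
    (neg_div_neg_eq _ _).symm
  have hFa : ∀ j t, chain w ψ C A x (q + 1) (2 * (j + 1)) t = 0 → F (a j) t = 0 := by
    intro j t ht
    rw [chain_even] at ht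
    have : F (a j) t = combination ψ A x (q + 1) (j + 1) t / (-(x q) ^ 2) ^ (j + 1) := by
      rw [combination, Finset.sum_div]
      refine Finset.sum_congr rfl fun k hk => ?_
      have hkq : k ≤ q := Nat.lt_succ_iff.1 (Finset.mem_range.1 hk)
      simp only [ha, hkq, if_true, hratio, div_pow]
      ring
    rw [this, ht, zero_div]
  have hGa : ∀ j t, chain w ψ C A x (q + 1) (2 * (j + 1) + 1) t = 0 → G (a j) t = 0 := by
    intro j t ht
    rw [chain_odd] at ht
    have : G (a j) t =
        -(combination (flux w ψ) A x (q + 1) (j + 1 + 1) t / (-(x q) ^ 2) ^ (j + 1)) := by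
      rw [combination, Finset.sum_div, ← Finset.sum_neg_distrib]
      refine Finset.sum_congr rfl fun k hk => ?_
      have hkq : k ≤ q := Nat.lt_succ_iff.1 (Finset.mem_range.1 hk)
      simp only [ha, hkq, if_true, hratio, div_pow]
      rw [pow_succ (-(x k) ^ 2) (j + 1)]
      ring
    rw [this, ht, zero_div, neg_zero]
  have hmain : HasDistinctZeros (F a₀) τ N := by
    refine hasDistinctZeros_of_frequently hFc hGc ?_ ?_ (hlim.frequently
      (Frequently.of_forall fun j => ?_))
    -- The limit takes the value `A q ≠ 0` at `t = 0`, so zeros cannot escape to the singular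
    -- endpoint.
    · have hev : ∀ᶠ p : (ℕ → ℝ) × ℝ in 𝓝 (a₀, 0), F p.1 p.2 ≠ 0 :=
        hFc.continuousAt.eventually_ne (by simp [hF₀, h.at_zero, hq])
      rw [nhds_prod_eq, eventually_prod_iff] at hev
      obtain ⟨pa, hpa, pb, hpb, hp⟩ := hev
      obtain ⟨δ, hδ, hball⟩ := Metric.eventually_nhds_iff.1 hpb
      refine ⟨δ, hδ, ?_⟩
      filter_upwards [hpa] with y hy t ht
      exact hp hy (hball (by rw [Real.dist_eq, sub_zero, abs_of_pos ht.1]; exact ht.2))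
    · intro t ht h1 h2
      rw [hF₀] at h1
      rw [hG₀] at h2
      have := hx0 q
      exact h.not_both_zero ht.1 ((mul_eq_zero.1 h1).resolve_left hq)
        ((mul_eq_zero.1 h2).resolve_left (mul_ne_zero hq (by positivity)))
    · obtain ⟨t, ht, hpos⟩ := hz j
      refine ⟨t, fun k hk => ⟨⟨hpos k hk, (ht.mem k hk).2⟩, hFa j _ (ht.zero k 0 hk rfl)⟩,
        fun k hk => ⟨ht.mono k (k + 1) (by omega) hk, ?_⟩⟩
      obtain ⟨s, hs, hs0⟩ := ht.exists_zero_between (h.isChain C A x (q + 1)) hk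
      exact ⟨s, hs, hGa j s hs0⟩
  obtain ⟨t, h1, h2⟩ := hmain
  exact ⟨t, h1, fun k hk => ⟨(h2 k hk).1, (mul_eq_zero.1 (hF₀ _ ▸ (h2 k hk).2)).resolve_left hq⟩⟩

theorem isChebyshevSystem_psi (h : SLFamily w ψ) (hτ : 0 < τ) :
    IsChebyshevSystem (fun k => ψ (nthSmallest {y | 0 < y ∧ ψ y τ = 0} k)) (Ioo 0 τ) := by
  have hfin := h.finite_psi_zeros hτ
  have hinf := h.infinite_psi_zeros hτ
  set x := nthSmallest {y | 0 < y ∧ ψ y τ = 0} with hx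
  have hmem : ∀ k, 0 < x k ∧ ψ (x k) τ = 0 := nthSmallest_mem hfin hinf
  refine isChebyshevSystem_of_top_coeff fun q A hq => ?_
  by_contra hcon
  have hR := h.isChain 0 A x (q + 1)
  have hp : (fun t => ∑ k ∈ Finset.range (q + 1), A k * ψ (x k) t) =
      chain w ψ 0 A x (q + 1) 0 := by
    funext t
    rw [chain_zero, zero_add]
  rw [hp] at hcon
  obtain ⟨t, ht, htI⟩ := exists_zeroSeq_of_zeroCount (R := chain w ψ 0 A x (q + 1)) (i := 0)
    Ioo_subset_Icc_self interior_Ioo (fun a ha m => hR.vanish ha.1 m 0) (fun _ _ e => e) hcon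
  have heven : ∀ j, chain w ψ 0 A x (q + 1) (2 * j) τ = 0 := fun j => by
    simp [chain_even', combination, hmem]
  -- Solutions vanish at `τ` and fluxes at `0`, so each differentiation is compensated by one
  -- endpoint and the number `q + 1` of interior zeros is preserved.
  have hzeros : ∀ j, HasInteriorZeros (chain w ψ 0 A x (q + 1)) τ (2 * j) (q + 1) := by
    intro j
    induction j with
    | zero => exact ⟨t, ht, htI⟩
    | succ j ih =>
      exact (ih.succ_right hR hτ (heven j)).succ_left hR hτ
        (chain_odd_eq_zero j fun k => flux_zero _)
  -- The zero at `τ` comes on top of the `q + 1` interior zeros, one more than the oscillation count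
  -- permits.
  have hdist : HasDistinctZeros (ψ (x q)) τ (q + 1 + 1) := by
    refine h.hasDistinctZeros_of_chain (C := 0) (nthSmallest_strictMono hfin hinf)
      (fun k => (hmem k).1) hq fun j => ?_
    obtain ⟨s, hs, hsI⟩ := hzeros (j + 1)
    refine ⟨_, hs.append hτ (fun k hk => (hsI k hk).2) (heven (j + 1)), fun k _ => ?_⟩
    by_cases hk : k < q + 1
    · simpa only [hk, if_true] using (hsI k hk).1
    · simpa only [hk, if_false] using hτ
  have := (h.le_encard_of_psi_zeros (hmem q).1.le hdist).trans
    (encard_inter_Iic_nthSmallest_le hfin hinf q)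
  have : q + 1 + 1 ≤ q + 1 := by exact_mod_cast this
  omega

/-- Combinations of the solutions with vanishing flux at `τ`. -/
theorem le_of_hasInteriorZeros_two (h : SLFamily w ψ) (hτ : 0 < τ) {q N : ℕ} (hq : A q ≠ 0)
    (hz : HasInteriorZeros
      (chain w ψ C A (nthSmallest {y | 0 < y ∧ flux w ψ y τ = 0}) (q + 1)) τ 2 N) : N ≤ q + 1 := by
  have hfin := h.finite_flux_zeros hτ
  have hinf := h.infinite_flux_zeros hτ
  set x := nthSmallest {y | 0 < y ∧ flux w ψ y τ = 0} with hx
  have hmem : ∀ k, 0 < x k ∧ flux w ψ (x k) τ = 0 := nthSmallest_mem hfin hinf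
  have hR := h.isChain C A x (q + 1)
  rcases Nat.eq_zero_or_pos N with rfl | hN
  · omega
  obtain ⟨M, rfl⟩ : ∃ M, N = M + 1 := ⟨N - 1, by omega⟩
  -- Here the fluxes vanish at both endpoints and nothing is known of the solutions there: one zero
  -- is lost on the way to the flux and one is regained on the way back.
  have hzeros : ∀ j, HasInteriorZeros (chain w ψ C A x (q + 1)) τ (2 * (j + 1)) (M + 1) := by
    intro j
    induction j with
    | zero => exact hz
    | succ j ih =>
      obtain ⟨t, ht, -⟩ := ih
      exact (ht.rolle hR).succ_both hR hτ (chain_odd_eq_zero (j + 1) fun k => flux_zero _)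
        (chain_odd_eq_zero (j + 1) fun k => (hmem k).2)
  have hdist : HasDistinctZeros (ψ (x q)) τ (M + 1) :=
    h.hasDistinctZeros_of_chain (C := C) (nthSmallest_strictMono hfin hinf)
      (fun k => (hmem k).1) hq fun j => by
        obtain ⟨t, ht, htI⟩ := hzeros j
        exact ⟨t, ht, fun k hk => (htI k hk).1⟩
  obtain ⟨t, ht1, ht2⟩ := hdist.rolle (h.exists_flux_zero_between (hmem q).1)
  -- The parameters are counted by fluxes, so the zeros of `ψ (x q)` are converted: Rolle's theorem
  -- gives `M` zeros of the flux, and `τ` is one more.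
  have hflux : HasDistinctZeros (flux w ψ (x q)) τ (M + 1) := by
    refine ⟨fun k => if k < M then t k else τ, fun k l hkl hl => ?_, fun k hk => ?_⟩
    · have hk : k < M := by omega
      by_cases hl' : l < M
      · simpa only [hk, hl', if_true] using ht1 k l hkl hl'
      · simpa only [hk, hl', if_true, if_false] using (ht2 k hk).1.2
    · by_cases hk' : k < M
      · simpa only [hk', if_true] using ⟨Ioo_subset_Ioc_self (ht2 k hk').1, (ht2 k hk').2⟩
      · simpa only [hk', if_false] using ⟨⟨hτ, le_rfl⟩, (hmem q).2⟩
  have := (h.le_encard_of_flux_zeros (hmem q).1.le hflux).trans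
    (encard_inter_Iic_nthSmallest_le hfin hinf q)
  exact_mod_cast this

/-- Flux zeros at both endpoints add one zero in passing to the next level. This is the common bound
for the three systems built on the zeros of the flux. -/
theorem le_of_hasInteriorZeros_one (h : SLFamily w ψ) (hτ : 0 < τ) {q N : ℕ} (hq : A q ≠ 0)
    (hz : HasInteriorZeros
      (chain w ψ C A (nthSmallest {y | 0 < y ∧ flux w ψ y τ = 0}) (q + 1)) τ 1 N) : N ≤ q := by
  have hmem := nthSmallest_mem (h.finite_flux_zeros hτ) (h.infinite_flux_zeros hτ)
  have := h.le_of_hasInteriorZeros_two hτ hq (hz.succ_both (h.isChain C A _ (q + 1)) hτ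
    (chain_odd_eq_zero 0 fun k => flux_zero _) (chain_odd_eq_zero 0 fun k => (hmem k).2))
  omega

theorem isChebyshevSystem_consOne (h : SLFamily w ψ) (hτ : 0 < τ) :
    IsChebyshevSystem (consOne fun k => ψ (nthSmallest {y | 0 < y ∧ flux w ψ y τ = 0} k))
      (Icc 0 τ) := by
  set x := nthSmallest {y | 0 < y ∧ flux w ψ y τ = 0} with hx
  refine isChebyshevSystem_of_top_coeff fun q A hq => ?_
  by_contra hcon
  have hR := h.isChain (A 0) (fun k => A (k + 1)) x q
  have hp : (fun t => ∑ k ∈ Finset.range (q + 1), A k * consOne (fun k => ψ (x k)) k t) =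
      chain w ψ (A 0) (fun k => A (k + 1)) x q 0 := by
    funext t
    rw [chain_zero, Finset.sum_range_succ', add_comm]
    simp [consOne]
  rw [hp] at hcon
  obtain ⟨t, ht, -⟩ := exists_zeroSeq_of_zeroCount
    (R := chain w ψ (A 0) (fun k => A (k + 1)) x q) (i := 0)
    Subset.rfl interior_Icc (fun a ha m => hR.vanish ha.1 m 0) (fun _ _ e => e) hcon
  -- For `q = 0` the combination is a nonzero constant. Otherwise the constant counts as one of the
  -- `q + 1` functions, and Rolle's theorem removes both it and one zero.
  cases q with
  | zero =>
    have := ht.zero 0 0 (by omega) rfl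
    rw [chain_zero] at this
    exact hq (by simpa using this)
  | succ q =>
    have hmem := nthSmallest_mem (h.finite_flux_zeros hτ) (h.infinite_flux_zeros hτ)
    have := h.le_of_hasInteriorZeros_one (C := A 0) (A := fun k => A (k + 1)) hτ hq (ht.rolle hR)
    omega

theorem isChebyshevSystem_deriv (h : SLFamily w ψ) (hτ : 0 < τ) :
    IsChebyshevSystem (fun k => _root_.deriv (ψ (nthSmallest {y | 0 < y ∧ flux w ψ y τ = 0} k)))
      (Ioo 0 τ) := by
  set x := nthSmallest {y | 0 < y ∧ flux w ψ y τ = 0} with hx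
  refine isChebyshevSystem_of_top_coeff fun q A hq => ?_
  by_contra hcon
  have hR := h.isChain 0 A x (q + 1)
  have hp : ∀ s, 0 < s → ∑ k ∈ Finset.range (q + 1), A k * _root_.deriv (ψ (x k)) s =
      _root_.deriv (chain w ψ 0 A x (q + 1) 0) s := by
    intro s hs
    rw [funext chain_zero]
    refine (HasDerivAt.deriv ?_).symm
    exact (HasDerivAt.fun_sum fun k _ =>
      (h.hasDerivAt (x k) hs.le).differentiableAt.hasDerivAt.const_mul _).const_add _
  obtain ⟨t, ht, htI⟩ := exists_zeroSeq_of_zeroCount (R := chain w ψ 0 A x (q + 1)) (i := 1)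
    -- The combination is `w⁻¹` times the chain at level one, so it has the same zeros and
    -- multiplicities on `(0, τ)`. Agreement on `(0, ∞)` is enough, since multiplicities are local.
    Ioo_subset_Icc_self interior_Ioo (fun a ha m hm => by
      refine hR.vanish ha.1 m 1 (hR.iteratedDeriv_succ_eq_zero ha.1 fun j hj => ?_)
      refine (EventuallyEq.iteratedDeriv_eq j ?_).symm.trans (hm j hj)
      filter_upwards [lt_mem_nhds ha.1] with s hs using hp s hs)
    (fun a ha e => by
      rw [hp a ha.1, (hR.deriv 0 a ha.1).deriv] at e
      exact (mul_eq_zero.1 e).resolve_left (hR.ne 0 a ha.1)) hcon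
  have := h.le_of_hasInteriorZeros_one hτ hq ⟨t, ht, htI⟩
  omega

theorem isChebyshevSystem_sub (h : SLFamily w ψ) (hτ : 0 < τ) :
    IsChebyshevSystem (fun k t => ψ (nthSmallest {y | 0 < y ∧ flux w ψ y τ = 0} k) t -
      ψ (nthSmallest {y | 0 < y ∧ flux w ψ y τ = 0} k) τ) (Ioo 0 τ) := by
  set x := nthSmallest {y | 0 < y ∧ flux w ψ y τ = 0} with hx
  refine isChebyshevSystem_of_top_coeff fun q A hq => ?_
  by_contra hcon
  obtain ⟨C, hC⟩ : ∃ C, C = -∑ k ∈ Finset.range (q + 1), A k * ψ (x k) τ := ⟨_, rfl⟩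
  have hR := h.isChain C A x (q + 1)
  have hp : (fun t => ∑ k ∈ Finset.range (q + 1), A k * (ψ (x k) t - ψ (x k) τ)) =
      chain w ψ C A x (q + 1) 0 := by
    funext t
    simp only [chain_zero, hC, mul_sub, Finset.sum_sub_distrib]
    ring
  rw [hp] at hcon
  obtain ⟨t, ht, htI⟩ := exists_zeroSeq_of_zeroCount (R := chain w ψ C A x (q + 1)) (i := 0)
    Ioo_subset_Icc_self interior_Ioo (fun a ha m => hR.vanish ha.1 m 0) (fun _ _ e => e) hcon
  have hτ0 : chain w ψ C A x (q + 1) 0 τ = 0 := by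
    rw [chain_zero, hC]
    ring
  have hz : HasInteriorZeros (chain w ψ C A x (q + 1)) τ 0 (q + 1) := ⟨t, ht, htI⟩
  -- The combination also vanishes at `τ`, so no zero is lost in the first differentiation.
  have := h.le_of_hasInteriorZeros_one hτ hq (hz.succ_right hR hτ hτ0)
  omega

end SLFamily

/-! ### Jacobi functions as a Sturm–Liouville family. -/

/-- The flux `w d'` of a solution of `(w d')' = -μ w d` that is regular at `0`. -/
theorem mul_deriv_eq_neg_integral {w d D : ℝ → ℝ} {μ : ℝ} (hw : Continuous w) (hw0 : w 0 = 0)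
    (hpos : ∀ t, 0 < t → 0 < w t) (hdc : Continuous d) (hd0 : HasDerivAt d 0 0)
    (hd : ∀ t, 0 < t → HasDerivAt d (D t) t)
    (hode : ∀ t, 0 < t → HasDerivAt (fun s => w s * D s) (-(μ * w t * d t)) t) {t : ℝ}
    (ht : 0 < t) : w t * D t = -(μ * ∫ s in (0 : ℝ)..t, w s * d s) := by
  -- `H` is constant on `(0, ∞)`, and the constant must be shown to be `0`. Boundedness of `D` near
  -- `0` is not known, but the mean value theorem gives points `ξ` close to `0` with `|D ξ| ≤ 1`,
  -- where `w ξ * D ξ` is small because `w 0 = 0`.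
  set H : ℝ → ℝ := fun s => w s * D s + μ * ∫ r in (0 : ℝ)..s, w r * d r with hH
  have hHd : ∀ s, 0 < s → HasDerivAt H 0 s := fun s hs => by
    refine ((hode s hs).add
      ((((hw.mul hdc).integral_hasStrictDerivAt 0 s).hasDerivAt).const_mul μ)).congr_deriv ?_
    simp only [Pi.mul_apply]
    ring
  have hconst : ∀ s, 0 < s → H s = H t := fun s hs =>
    isOpen_Ioi.is_const_of_deriv_eq_zero isPreconnected_Ioi
      (fun x hx => (hHd x hx).differentiableAt.differentiableWithinAt)
      (fun x hx => (hHd x hx).deriv) hs ht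
  by_contra hne
  have hHt : H t ≠ 0 := fun h => hne (by simp only [hH] at h; linarith)
  have hcont : Continuous fun s => |H t - μ * ∫ r in (0 : ℝ)..s, w r * d r| - w s := by
    have := intervalIntegral.continuous_primitive (μ := MeasureTheory.volume)
      (fun a b => (hw.mul hdc).intervalIntegrable a b) 0
    simp only [Pi.mul_apply] at this
    fun_prop
  have hev : ∀ᶠ s in 𝓝 (0 : ℝ), 0 < |H t - μ * ∫ r in (0 : ℝ)..s, w r * d r| - w s :=
    continuousAt_const.eventually_lt hcont.continuousAt (by simpa [hw0] using hHt)
  obtain ⟨ε, hε, hball⟩ := Metric.eventually_nhds_iff.1 (hev.and (hd0.isLittleO.def one_pos))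
  have hs0 : 0 < ε / 2 := by linarith
  have hs := (hball (y := ε / 2) (by
    rw [Real.dist_eq, sub_zero, abs_of_pos hs0]; linarith)).2
  simp only [sub_zero, smul_zero, Real.norm_eq_abs, one_mul, abs_of_pos hs0] at hs
  obtain ⟨ξ, hξ, hξe⟩ := exists_hasDerivAt_eq_slope d D hs0 hdc.continuousOn
    (fun x hx => hd x hx.1)
  have hDξ : |D ξ| ≤ 1 := by
    rw [hξe, sub_zero, abs_div, abs_of_pos hs0, div_le_one hs0]
    exact hs
  have h1 := (hball (y := ξ) (by
    rw [Real.dist_eq, sub_zero, abs_of_pos hξ.1]; linarith [hξ.2])).1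
  rw [← hconst ξ hξ.1] at h1
  simp only [hH, add_sub_cancel_right] at h1
  have hwξ := hpos ξ hξ.1
  rw [abs_mul, abs_of_pos hwξ] at h1
  nlinarith

section Jacobi

variable {α β : ℝ}

theorem IsJacobiFunction.continuous {lam : ℝ} {φ : ℝ → ℝ} (h : IsJacobiFunction α β lam φ) :
    Continuous φ := by
  have hc : ContinuousOn φ (Ici 0) := by
    intro t ht
    rcases (mem_Ici.1 ht).eq_or_lt with rfl | ht
    · exact h.deriv_zero.continuousAt.continuousWithinAt
    · exact (h.differentiable t ht).continuousAt.continuousWithinAt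
  have : Continuous fun t => φ |t| := hc.comp_continuous continuous_abs fun t => abs_nonneg t
  refine this.congr fun t => ?_
  rcases abs_choice t with e | e <;> rw [e]
  exact h.even t

theorem jacobiWeight_abs_zero (hα : -1 / 2 < α) : jacobiWeight α β |0| = 0 := by
  have : 2 * α + 1 ≠ 0 := by linarith
  simp [jacobiWeight, Real.zero_rpow this]

theorem jacobiWeight_pos {t : ℝ} (ht : 0 < t) : 0 < jacobiWeight α β t := by
  have h1 := Real.sinh_pos_iff.2 ht
  have h2 := Real.cosh_pos t
  unfold jacobiWeight
  positivity

theorem hasDerivAt_jacobiWeight {t : ℝ} (ht : 0 < t) : HasDerivAt (jacobiWeight α β)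
    (jacobiWeight α β t * ((2 * α + 1) * (Real.cosh t / Real.sinh t) +
      (2 * β + 1) * (Real.sinh t / Real.cosh t))) t := by
  have h1 := Real.sinh_pos_iff.2 ht
  have h2 := Real.cosh_pos t
  have d1 := (Real.hasDerivAt_sinh t).rpow_const (p := 2 * α + 1) (Or.inl h1.ne')
  have d2 := (Real.hasDerivAt_cosh t).rpow_const (p := 2 * β + 1) (Or.inl h2.ne')
  refine ((d1.const_mul ((2 : ℝ) ^ (2 * jacobiRho α β))).mul d2).congr_deriv ?_
  rw [Real.rpow_sub_one h1.ne', Real.rpow_sub_one h2.ne', jacobiWeight]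
  field_simp

theorem contDiffOn_jacobiWeight : ContDiffOn ℝ ∞ (jacobiWeight α β) (Ioi 0) := by
  refine (contDiffOn_const.mul ?_).mul ?_
  · exact Real.contDiff_sinh.contDiffOn.rpow_const_of_ne
      fun t ht => (Real.sinh_pos_iff.2 ht).ne'
  · exact Real.contDiff_cosh.contDiffOn.rpow_const_of_ne fun t _ => (Real.cosh_pos t).ne'

/-- The right side is `Δ'/Δ`. The difference factors as `(cosh - sinh) ((2α+1)/sinh - (2β+1)/cosh)`,
and this is where `β ≤ α` enters. -/
theorem two_mul_jacobiRho_le (hβ : -1 / 2 ≤ β) (hαβ : β ≤ α) {t : ℝ} (ht : 0 < t) :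
    2 * jacobiRho α β ≤ (2 * α + 1) * (Real.cosh t / Real.sinh t) +
      (2 * β + 1) * (Real.sinh t / Real.cosh t) := by
  have h1 := Real.sinh_pos_iff.2 ht
  have h2 := Real.cosh_pos t
  have h3 := Real.sinh_lt_cosh t
  have e : (2 * α + 1) * (Real.cosh t / Real.sinh t) + (2 * β + 1) * (Real.sinh t / Real.cosh t) -
      2 * jacobiRho α β = (Real.cosh t - Real.sinh t) *
        ((2 * α + 1) / Real.sinh t - (2 * β + 1) / Real.cosh t) := by
    unfold jacobiRho
    field_simp
    ring
  have h4 : (2 * β + 1) / Real.cosh t ≤ (2 * α + 1) / Real.sinh t :=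
    div_le_div₀ (by linarith) (by linarith) h1 h3.le
  have := mul_nonneg (sub_nonneg.2 h3.le) (sub_nonneg.2 h4)
  rw [← e] at this
  linarith

/-- The flux of a Jacobi function. -/
theorem jacobiWeight_mul_deriv_jacobiPhi (hβ : -1 / 2 ≤ β) (hα : -1 / 2 < α) (lam : ℝ) {t : ℝ}
    (ht : 0 < t) : jacobiWeight α β t * deriv (jacobiPhi α β lam) t =
      -((lam ^ 2 + jacobiRho α β ^ 2) *
        ∫ s in (0 : ℝ)..t, jacobiWeight α β |s| * jacobiPhi α β lam s) := by
  have h := jacobiPhi_spec hβ hα lam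
  have := mul_deriv_eq_neg_integral (w := fun t => jacobiWeight α β |t|)
    (μ := lam ^ 2 + jacobiRho α β ^ 2)
    (JacobiAux.weight_aux hβ hα).1 (jacobiWeight_abs_zero hα)
    (fun t ht => jacobiWeight_pos (abs_pos.2 ht.ne')) h.continuous h.deriv_zero
    (fun t ht => (h.differentiable t ht).hasDerivAt) (fun t ht => ?_) ht
  · simpa only [abs_of_pos ht] using this
  · rw [abs_of_pos ht]
    refine (h.ode t ht).congr_of_eventuallyEq ?_
    filter_upwards [lt_mem_nhds ht] with s hs
    rw [abs_of_pos hs]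

/-- Comparison of `φ_0` with the supersolution `exp (-ρ t)`. -/
theorem monotoneOn_jacobiPhi_mul_exp_of_nonneg (hβ : -1 / 2 ≤ β) (hαβ : β ≤ α) (hα : -1 / 2 < α)
    {T : ℝ} (hT : ∀ t ∈ Ioo 0 T, 0 ≤ jacobiPhi α β 0 t) :
    MonotoneOn (fun t => jacobiPhi α β 0 t * Real.exp (jacobiRho α β * t)) (Icc 0 T) := by
  have h := jacobiPhi_spec hβ hα 0
  have hρ : 0 < jacobiRho α β := by unfold jacobiRho; linarith
  have hwc := (JacobiAux.weight_aux hβ hα).1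
  have hφc := h.continuous
  have hflux := fun t (ht : 0 < t) => jacobiWeight_mul_deriv_jacobiPhi hβ hα 0 ht
  set ρ := jacobiRho α β with hρd
  set φ := jacobiPhi α β 0 with hφ
  -- For `t > 0` this is `exp (-ρ t) Δ (φ' + ρ φ)`. The integral form of the flux makes it
  -- continuous with value `0` at the singular point. Its derivative is `exp (-ρ t) ρ φ Δ (Δ'/Δ -
  -- 2ρ) ≥ 0`, so `φ' + ρ φ ≥ 0`.
  set X : ℝ → ℝ := fun t => Real.exp (-(ρ * t)) *
    (-((0 ^ 2 + ρ ^ 2) * ∫ s in (0 : ℝ)..t, jacobiWeight α β |s| * φ s) +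
      ρ * (jacobiWeight α β |t| * φ t)) with hX
  have hXc : Continuous X := by
    have := intervalIntegral.continuous_primitive (μ := MeasureTheory.volume)
      (fun a b => (hwc.mul hφc).intervalIntegrable a b) 0
    simp only [Pi.mul_apply] at this
    fun_prop
  have hXd : ∀ t, 0 < t → HasDerivAt X (Real.exp (-(ρ * t)) * (ρ * φ t * jacobiWeight α β t *
      ((2 * α + 1) * (Real.cosh t / Real.sinh t) + (2 * β + 1) * (Real.sinh t / Real.cosh t) -
        2 * ρ))) t := by
    intro t ht
    have e1 : HasDerivAt (fun t => Real.exp (-(ρ * t))) (Real.exp (-(ρ * t)) * -(ρ * 1)) t :=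
      (((hasDerivAt_id t).const_mul ρ).neg).exp
    have e2 := (((hwc.mul hφc).integral_hasStrictDerivAt 0 t).hasDerivAt.const_mul
      (0 ^ 2 + ρ ^ 2)).neg
    have e3 : HasDerivAt (fun t => jacobiWeight α β |t|) _ t :=
      (hasDerivAt_jacobiWeight (α := α) (β := β) ht).congr_of_eventuallyEq (by
        filter_upwards [lt_mem_nhds ht] with s hs
        rw [abs_of_pos hs])
    have e4 := ((e3.mul (h.differentiable t ht).hasDerivAt).const_mul ρ)
    refine (e1.mul (e2.add e4)).congr_deriv ?_
    simp only [Pi.add_apply, Pi.mul_apply, Pi.neg_apply, abs_of_pos ht]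
    linear_combination Real.exp (-(ρ * t)) * ρ * hflux t ht
  have hXmono : MonotoneOn X (Icc 0 T) := by
    refine monotoneOn_of_deriv_nonneg (convex_Icc _ _) hXc.continuousOn (fun t ht => ?_)
      (fun t ht => ?_) <;> rw [interior_Icc] at ht
    · exact (hXd t ht.1).differentiableAt.differentiableWithinAt
    · rw [(hXd t ht.1).deriv]
      have a1 := hT t ht
      have a2 := (jacobiWeight_pos (α := α) (β := β) ht.1).le
      have a3 := sub_nonneg.2 (two_mul_jacobiRho_le hβ hαβ ht.1)
      positivity
  have hX0 : X 0 = 0 := by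
    simp only [hX, jacobiWeight_abs_zero hα]
    simp
  have hPd : ∀ t, 0 < t → HasDerivAt (fun t => φ t * Real.exp (ρ * t))
      (Real.exp (ρ * t) * (Real.exp (ρ * t) * X t / jacobiWeight α β t)) t := by
    intro t ht
    have e1 : HasDerivAt (fun t => Real.exp (ρ * t)) (Real.exp (ρ * t) * (ρ * 1)) t :=
      ((hasDerivAt_id t).const_mul ρ).exp
    refine ((h.differentiable t ht).hasDerivAt.mul e1).congr_deriv ?_
    have hw := (jacobiWeight_pos (α := α) (β := β) ht).ne'
    simp only [hX]
    rw [← hflux t ht, abs_of_pos ht, ← mul_assoc (Real.exp (ρ * t)) (Real.exp (-(ρ * t))),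
      ← Real.exp_add, add_neg_cancel, Real.exp_zero]
    field_simp
  refine monotoneOn_of_deriv_nonneg (convex_Icc _ _) (by fun_prop) (fun t ht => ?_)
    (fun t ht => ?_) <;> rw [interior_Icc] at ht
  · exact (hPd t ht.1).differentiableAt.differentiableWithinAt
  · rw [(hPd t ht.1).deriv]
    have a1 : 0 ≤ X t := hX0 ▸ hXmono ⟨le_rfl, (ht.1.trans ht.2).le⟩ ⟨ht.1.le, ht.2.le⟩ ht.1.le
    have a2 := (jacobiWeight_pos (α := α) (β := β) ht.1).le
    positivity

/-- Up to its first zero, `φ_0 exp (ρ t)` is nondecreasing from the value `1`, so there is no first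
zero. -/
theorem jacobiPhi_zero_pos (hβ : -1 / 2 ≤ β) (hαβ : β ≤ α) (hα : -1 / 2 < α) (t : ℝ) :
    0 < jacobiPhi α β 0 t := by
  have h := jacobiPhi_spec hβ hα 0
  have key : ∀ t, 0 ≤ t → 0 < jacobiPhi α β 0 t := by
    intro t ht
    by_contra! hneg
    have hcl : IsCompact (Icc 0 t ∩ {s | jacobiPhi α β 0 s ≤ 0}) :=
      isCompact_Icc.inter_right (isClosed_le h.continuous continuous_const)
    obtain ⟨T, ⟨⟨hT0, hTt⟩, hT⟩, hmin⟩ := hcl.exists_isLeast ⟨t, ⟨ht, le_rfl⟩, hneg⟩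
    have hmono := monotoneOn_jacobiPhi_mul_exp_of_nonneg hβ hαβ hα (T := T) (fun s hs => by
      by_contra! hs'
      exact absurd (hmin ⟨⟨hs.1.le, hs.2.le.trans hTt⟩, hs'.le⟩) (not_le.2 hs.2))
      ⟨le_rfl, hT0⟩ ⟨hT0, le_rfl⟩ hT0
    simp only [h.map_zero, mul_zero, Real.exp_zero, mul_one] at hmono
    have := mul_nonpos_of_nonpos_of_nonneg hT (Real.exp_pos (jacobiRho α β * T)).le
    linarith
  rcases le_total 0 t with ht | ht
  · exact key t ht
  · rw [← h.even]
    exact key (-t) (by linarith)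

/-- Bootstrapping: the flux formula writes `φ'` as a multiple of `Δ⁻¹ ∫ Δ φ`, so each order of
smoothness yields the next. -/
theorem contDiffOn_jacobiPhi (hβ : -1 / 2 ≤ β) (hα : -1 / 2 < α) (lam : ℝ) :
    ContDiffOn ℝ ∞ (jacobiPhi α β lam) (Ioi 0) := by
  have h := jacobiPhi_spec hβ hα lam
  have hwc := (JacobiAux.weight_aux hβ hα).1
  have hw : ∀ n : ℕ, ContDiffOn ℝ n (jacobiWeight α β) (Ioi 0) :=
    contDiffOn_infty.1 contDiffOn_jacobiWeight
  refine contDiffOn_infty.2 fun n => ?_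
  induction n with
  | zero => exact contDiffOn_zero.2 h.continuous.continuousOn
  | succ n ih =>
    have hI : ContDiffOn ℝ n
        (fun t => ∫ s in (0 : ℝ)..t, jacobiWeight α β |s| * jacobiPhi α β lam s) (Ioi 0) := by
      have hd : ∀ t, HasDerivAt
          (fun t => ∫ s in (0 : ℝ)..t, jacobiWeight α β |s| * jacobiPhi α β lam s)
          (jacobiWeight α β |t| * jacobiPhi α β lam t) t := fun t =>
        ((hwc.mul h.continuous).integral_hasStrictDerivAt 0 t).hasDerivAt
      refine ContDiffOn.of_le (n := n + 1) ?_ (by exact_mod_cast Nat.le_succ n)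
      rw [contDiffOn_succ_iff_deriv_of_isOpen isOpen_Ioi]
      refine ⟨fun t _ => (hd t).differentiableAt.differentiableWithinAt,
        fun h => absurd h (by simp), ((hw n).mul ih).congr fun t ht => ?_⟩
      rw [(hd t).deriv, abs_of_pos ht]
    rw [Nat.cast_succ, contDiffOn_succ_iff_deriv_of_isOpen isOpen_Ioi]
    refine ⟨fun t ht => (h.differentiable t ht).differentiableWithinAt,
      fun h => absurd h (by simp),
      ((contDiffOn_const (c := -(lam ^ 2 + jacobiRho α β ^ 2))).mul (hI.div (hw n)
        fun t ht => (jacobiWeight_pos ht).ne')).congr fun t ht => ?_⟩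
    have hwt := (jacobiWeight_pos (α := α) (β := β) ht).ne'
    rw [Pi.div_apply, ← mul_div_assoc, eq_div_iff hwt, mul_comm,
      jacobiWeight_mul_deriv_jacobiPhi hβ hα lam ht]
    ring

theorem monotoneOn_jacobiWeight_mul_exp (hβ : -1 / 2 ≤ β) (hαβ : β ≤ α) (hα : -1 / 2 < α) :
    MonotoneOn (fun t => jacobiWeight α β |t| * Real.exp (-(2 * jacobiRho α β * t))) (Ici 0) := by
  have hwc := (JacobiAux.weight_aux hβ hα).1
  have hd : ∀ t, 0 < t → HasDerivAt
      (fun t => jacobiWeight α β |t| * Real.exp (-(2 * jacobiRho α β * t)))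
      (jacobiWeight α β t * Real.exp (-(2 * jacobiRho α β * t)) *
        ((2 * α + 1) * (Real.cosh t / Real.sinh t) + (2 * β + 1) * (Real.sinh t / Real.cosh t) -
        2 * jacobiRho α β)) t := by
    intro t ht
    have e1 : HasDerivAt (fun t => jacobiWeight α β |t|) _ t :=
      (hasDerivAt_jacobiWeight (α := α) (β := β) ht).congr_of_eventuallyEq (by
        filter_upwards [lt_mem_nhds ht] with s hs
        rw [abs_of_pos hs])
    have e2 : HasDerivAt (fun t => Real.exp (-(2 * jacobiRho α β * t)))
        (Real.exp (-(2 * jacobiRho α β * t)) * -(2 * jacobiRho α β * 1)) t :=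
      (((hasDerivAt_id t).const_mul (2 * jacobiRho α β)).neg).exp
    refine (e1.mul e2).congr_deriv ?_
    rw [abs_of_pos ht]
    ring
  refine monotoneOn_of_deriv_nonneg (convex_Ici _) (by fun_prop) (fun t ht => ?_)
    (fun t ht => ?_) <;> rw [interior_Ici] at ht
  · exact (hd t ht).differentiableAt.differentiableWithinAt
  · rw [(hd t ht).deriv]
    have a2 := (jacobiWeight_pos (α := α) (β := β) ht).le
    have a3 := sub_nonneg.2 (two_mul_jacobiRho_le hβ hαβ ht)
    positivity

/-- The normalized Jacobi functions solve `(w ψ')' + lam² w ψ = 0` with `w = Δ φ_0²`. -/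
theorem slFamily_jacobiPsi (hβ : -1 / 2 ≤ β) (hαβ : β ≤ α) (hα : -1 / 2 < α) :
    SLFamily (fun t => jacobiWeight α β |t| * jacobiPhi α β 0 t ^ 2) (jacobiPsi α β) := by
  have h := jacobiPhi_spec hβ hα
  have hpos := jacobiPhi_zero_pos hβ hαβ hα
  have hwc := (JacobiAux.weight_aux hβ hα).1
  have hcont : Continuous fun t => jacobiWeight α β |t| * jacobiPhi α β 0 t ^ 2 :=
    hwc.mul ((h 0).continuous.pow 2)
  have hw0 : jacobiWeight α β |0| * jacobiPhi α β 0 0 ^ 2 = 0 := by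
    rw [jacobiWeight_abs_zero hα, zero_mul]
  have hwpos : ∀ t, 0 < t → 0 < jacobiWeight α β |t| * jacobiPhi α β 0 t ^ 2 := fun t ht =>
    mul_pos (jacobiWeight_pos (abs_pos.2 ht.ne')) (pow_pos (hpos t) 2)
  have hd0 : ∀ lam, HasDerivAt (jacobiPsi α β lam) 0 0 := fun lam =>
    ((h lam).deriv_zero.div (h 0).deriv_zero (hpos 0).ne').congr_deriv (by simp)
  have hd : ∀ lam t, 0 < t → HasDerivAt (jacobiPsi α β lam)
      ((deriv (jacobiPhi α β lam) t * jacobiPhi α β 0 t -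
        jacobiPhi α β lam t * deriv (jacobiPhi α β 0) t) / jacobiPhi α β 0 t ^ 2) t :=
    fun lam t ht => ((h lam).differentiable t ht).hasDerivAt.div
      ((h 0).differentiable t ht).hasDerivAt (hpos t).ne'
  refine ⟨hcont, hwpos, ?_, ?_, fun t => div_self (hpos t).ne', fun lam t => ?_, fun lam => ?_,
    fun lam t ht => ?_⟩
  · have hP : MonotoneOn (fun t => jacobiPhi α β 0 t * Real.exp (jacobiRho α β * t)) (Ici 0) := by
      intro s hs t ht hst
      exact monotoneOn_jacobiPhi_mul_exp_of_nonneg hβ hαβ hα (T := t) (fun s _ => (hpos s).le)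
        ⟨hs, hst⟩ ⟨ht, le_rfl⟩ hst
    intro s hs t ht hst
    -- The exponentials cancel in `Δ φ_0² = (Δ exp (-2ρt)) (φ_0 exp (ρt))²`, and both factors are
    -- nondecreasing.
    have e : ∀ t, jacobiWeight α β |t| * jacobiPhi α β 0 t ^ 2 =
        jacobiWeight α β |t| * Real.exp (-(2 * jacobiRho α β * t)) *
          (jacobiPhi α β 0 t * Real.exp (jacobiRho α β * t)) ^ 2 := by
      intro t
      have : Real.exp (-(2 * jacobiRho α β * t)) * Real.exp (jacobiRho α β * t) ^ 2 = 1 := by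
        rw [← Real.exp_nat_mul, ← Real.exp_add]
        rw [← Real.exp_zero]
        congr 1
        push_cast
        ring
      rw [mul_pow, mul_mul_mul_comm, this, mul_one]
    simp only [e]
    have a1 := monotoneOn_jacobiWeight_mul_exp hβ hαβ hα hs ht hst
    have a2 := pow_le_pow_left₀ (mul_pos (hpos s) (Real.exp_pos _)).le (hP hs ht hst) 2
    have a3 : 0 ≤ jacobiWeight α β |t| := by
      rcases (mem_Ici.1 ht).eq_or_lt with rfl | ht0
      · exact (jacobiWeight_abs_zero hα).ge
      · exact (jacobiWeight_pos (abs_pos.2 ht0.ne')).le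
    exact mul_le_mul a1 a2 (by positivity) (by positivity)
  · exact (contDiffOn_jacobiWeight.mul ((contDiffOn_jacobiPhi hβ hα 0).pow 2)).congr
      fun t ht => by rw [abs_of_pos ht]
  · simp only [jacobiPsi, (h _).even]
  · simp [jacobiPsi, (h _).map_zero]
  · rcases ht.eq_or_lt with rfl | ht
    · simpa using hd0 lam
    have hψc : Continuous (jacobiPsi α β lam) :=
      (h lam).continuous.div (h 0).continuous fun t => (hpos t).ne'
    refine (hd lam t ht).congr_deriv ?_
    rw [← mul_div_assoc, ← neg_div, eq_div_iff (hwpos t ht).ne', mul_comm]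
    refine mul_deriv_eq_neg_integral (w := fun t => jacobiWeight α β |t| * jacobiPhi α β 0 t ^ 2)
      (D := fun t => (deriv (jacobiPhi α β lam) t * jacobiPhi α β 0 t -
        jacobiPhi α β lam t * deriv (jacobiPhi α β 0) t) / jacobiPhi α β 0 t ^ 2)
      hcont hw0 hwpos hψc (hd0 lam) (hd lam) (fun t ht => ?_) ht
    -- The flux `w ψ'` equals the Wronskian `Δ (φ_λ' φ_0 - φ_λ φ_0')`. In its derivative the terms
    -- with `ρ²` cancel, leaving `-λ² Δ φ_λ φ_0 = -λ² w ψ_λ`.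
    have e := (((h 0).differentiable t ht).hasDerivAt.mul ((h lam).ode t ht)).sub
      (((h lam).differentiable t ht).hasDerivAt.mul ((h 0).ode t ht))
    refine (e.congr_of_eventuallyEq ?_).congr_deriv ?_
    · filter_upwards [lt_mem_nhds ht] with s hs
      have := (hpos s).ne'
      simp only [Pi.sub_apply, Pi.mul_apply, abs_of_pos hs]
      field_simp
    · have := (hpos t).ne'
      simp only [jacobiPsi, abs_of_pos ht]
      field_simp
      ring

theorem jacobiZeroStar_eq (hβ : -1 / 2 ≤ β) (hαβ : β ≤ α) (hα : -1 / 2 < α) {τ : ℝ} (hτ : 0 < τ) :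
    jacobiZeroStar α β τ = nthSmallest {lam | 0 < lam ∧ SLFamily.flux
      (fun t => jacobiWeight α β |t| * jacobiPhi α β 0 t ^ 2) (jacobiPsi α β) lam τ = 0} := by
  have h := slFamily_jacobiPsi hβ hαβ hα
  funext k
  unfold jacobiZeroStar
  congr 1
  ext lam
  refine and_congr_right fun hlam => ?_
  have hw := (h.w_pos τ hτ).ne'
  rw [(h.hasDerivAt lam hτ.le).deriv, neg_eq_zero, mul_eq_zero, div_eq_zero_iff]
  simp only [hw, or_false, pow_eq_zero_iff two_ne_zero, hlam.ne', false_or]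

end Jacobi

theorem theorem5 (α β τ : ℝ) (hβ : -1 / 2 ≤ β) (hαβ : β ≤ α) (hα : -1 / 2 < α) (hτ : 0 < τ) :
    (IsChebyshevSystem (fun k t => jacobiPsi α β (jacobiZero α β τ k) t) (Set.Ioo 0 τ) ∧
      IsChebyshevSystem (consOne (fun k t => jacobiPsi α β (jacobiZeroStar α β τ k) t))
        (Set.Icc 0 τ)) ∧
    (IsChebyshevSystem (fun k t => deriv (jacobiPsi α β (jacobiZeroStar α β τ k)) t)
        (Set.Ioo 0 τ) ∧
      IsChebyshevSystem (fun k t => jacobiPsi α β (jacobiZeroStar α β τ k) t -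
        jacobiPsi α β (jacobiZeroStar α β τ k) τ) (Set.Ioo 0 τ)) := by
  have h := slFamily_jacobiPsi hβ hαβ hα
  have hzero : jacobiZero α β τ = nthSmallest {lam | 0 < lam ∧ jacobiPsi α β lam τ = 0} := by
    funext k
    unfold jacobiZero
    congr 1
    ext lam
    simp [jacobiPsi, (jacobiPhi_zero_pos hβ hαβ hα τ).ne']
  rw [hzero, jacobiZeroStar_eq hβ hαβ hα hτ]
  exact ⟨⟨h.isChebyshevSystem_psi hτ, h.isChebyshevSystem_consOne hτ⟩,
    h.isChebyshevSystem_deriv hτ, h.isChebyshevSystem_sub hτ⟩
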